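/- Let $\mathbb{F}$ be a field of characteristic zero. *Words* are formal expressions built from two letters $a,b$ by a formal binary bracket $[\cdot,\cdot]$ and two formal unary projections $\pi^-,\pi^+$. A *word series* is a family of coefficients in $\mathbb{F}$ indexed by the words such that, for all $m,n\in\mathbb{N}$, only finitely many words with exactly $m$ letters $a$ and $n$ letters $b$ have a nonzero coefficient. If $\mathfrak{g}$ is a Lie algebra over $\mathbb{F}$ with a vector space decomposition $\mathfrak{g}=\mathfrak{g}^-\oplus\mathfrak{g}^+$ ($\mathfrak{g}^\pm$ need not be subalgebras), let $s,t$ be commuting formal variables commuting with $\mathfrak{g}$, let $\pi^\pm:\mathfrak{g}[[s,t]]\to\mathfrak{g}^\pm[[s,t]]$ be the corresponding projections, and let $h^\pm\in\mathfrak{g}^\pm[[s,t]]$. Every word series $F$ has a well-defined value $F(sh^-,th^+;\pi^\pm)\in\mathfrak{g}[[s,t]]$, obtained by substituting $a=sh^-$, $b=th^+$, evaluating brackets in $\mathfrak{g}[[s,t]]$, and interpreting the formal projections as $\pi^\pm$. Let $\mathbb{F}\langle\langle sh^-,th^+;\pi^\pm\rangle\rangle\subseteq\mathfrak{g}[[s,t]]$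 be the set of all these values. **Theorem.** There are word series $F^-,F^+,U^-,U^+$ over $\mathbb{F}$, independent of $\mathfrak{g}$, of $\mathfrak{g}^\pm$ and of $h^\pm$, such that $$F^-=a+\tfrac12\pi^-[b,a]+U^-,\qquad F^+=b+\tfrac12\pi^+[b,a]+U^+,$$ where $U^\pm$ involve only words with at least three letters, including at least one $a$ and at least one $b$, and such that the following holds for all $\mathfrak{g}=\mathfrak{g}^-\oplus\mathfrak{g}^+$ and $h^\pm\in\mathfrak{g}^\pm[[s,t]]$ as above. There are unique $g^\pm\in\mathfrak{g}^\pm[[s,t]]$ such that $$e^{sg^-}e^{tg^+}=e^{sh^-+th^+}\quad\text{in } U(\mathfrak{g})[[s,t]],$$ where $U(\mathfrak{g})$ is the universal enveloping algebra, and these satisfy $$sg^-,\,tg^+\in\mathbb{F}\langle\langle sh^-,th^+;\pi^\pm\rangle\rangle,$$ $$sg^-=F^-(sh^-,th^+;\pi^\pm),\qquad tg^+=F^+(sh^-,th^+;\pi^\pm),$$ $$sg^-=sh^-+\tfrac12\pi^-([th^+,sh^-])+u^-,\qquad tg^+=th^++\tfrac12\pi^+([th^+,sh^-])+u^+,$$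 with $u^\pm=U^\pm(sh^-,th^+;\pi^\pm)\in\mathbb{F}\langle\langle sh^-,th^+;\pi^\pm\rangle\rangle\cap\mathfrak{g}^\pm[[s,t]]$. -/

import Mathlib

noncomputable section

namespace FormalFactorization

/-- Formal power series in two commuting variables `s` (index `0`) and `t` (index `1`) with
coefficients in `M`; the coefficient of `s ^ m * t ^ n` in `f` is `f d` with `d 0 = m`, `d 1 = n`.
It is used for `M` a Lie algebra `𝔤` and for `M` its enveloping algebra. -/
abbrev Series (M : Type*) := MvPowerSeries (Fin 2) M

/-- Multiplication of a series by the variable with index `i`. -/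
def mulVar {M : Type*} [Zero M] (i : Fin 2) (f : Series M) : Series M :=
  fun d => if d i = 0 then 0 else f (d - Finsupp.single i 1)

/-- The Lie bracket of `𝔤[[s,t]]`, for which `s` and `t` commute with everything. -/
def seriesBracket {L : Type*} [LieRing L] (f g : Series L) : Series L :=
  fun d => ∑ p ∈ Finset.HasAntidiagonal.antidiagonal d, ⁅f p.1, g p.2⁆

/-- A linear map applied to every coefficient. -/
def mapCoeff {R M N : Type*} [Semiring R] [AddCommMonoid M] [AddCommMonoid N] [Module R M]
    [Module R N] (φ : M →ₗ[R] N) (f : Series M) : Series N :=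
  fun d => φ (f d)

/-- The subspace `V[[s,t]]` of `𝔤[[s,t]]` for a subspace `V` of `𝔤`. -/
def seriesIn {R M : Type*} [Semiring R] [AddCommMonoid M] [Module R M] (V : Submodule R M) :
    Submodule R (Series M) where
  carrier := {f | ∀ d, f d ∈ V}
  add_mem' hf hg d := V.add_mem (hf d) (hg d)
  zero_mem' _ := V.zero_mem
  smul_mem' c _ hf d := V.smul_mem c (hf d)

/-- The exponential `∑ n, f ^ n / n!`, formed coefficient by coefficient, of a series `f` over an
associative algebra. It is meant for `f` with zero constant term: then only finitely many `n`
contribute to each coefficient, see `finite_support_expSeries`. -/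
def expSeries (𝔽 : Type*) {A : Type*} [Field 𝔽] [Ring A] [Algebra 𝔽 A] (f : Series A) : Series A :=
  fun d => ∑ᶠ n : ℕ, ((n.factorial : 𝔽)⁻¹) • (f ^ n) d

theorem pow_apply_eq_zero {A : Type*} [Ring A] {f : Series A} (hf : f 0 = 0) (n : ℕ)
    (d : Fin 2 →₀ ℕ) (hd : d.degree < n) : (f ^ n) d = 0 := by
  induction n generalizing d with
  | zero => omega
  | succ n ih =>
    change MvPowerSeries.coeff d (f ^ (n + 1)) = 0
    rw [pow_succ, MvPowerSeries.coeff_mul]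
    refine Finset.sum_eq_zero fun p hp => ?_
    rw [Finset.HasAntidiagonal.mem_antidiagonal] at hp
    change (f ^ n) p.1 * f p.2 = 0
    by_cases h2 : p.2 = 0
    · rw [h2, hf, mul_zero]
    · have h3 : p.2.degree ≠ 0 := by
        rw [Ne, Finsupp.degree_eq_zero_iff]; exact h2
      have h4 : p.1.degree + p.2.degree = d.degree := by rw [← hp, map_add]
      rw [ih p.1 (by omega), zero_mul]

theorem finite_support_expSeries (𝔽 : Type*) {A : Type*} [Field 𝔽] [Ring A] [Algebra 𝔽 A]
    {f : Series A} (hf : f 0 = 0) (d : Fin 2 →₀ ℕ) :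
    (Function.support fun n : ℕ => ((n.factorial : 𝔽)⁻¹) • (f ^ n) d).Finite := by
  refine (Set.finite_Iic d.degree).subset fun n hn => ?_
  by_contra h
  rw [Set.mem_Iic, not_le] at h
  exact hn (by simp only [pow_apply_eq_zero hf n d h, smul_zero])

section Exponential

attribute [local instance 100] LieRing.ofAssociativeRing

/-- For `f` in `𝔤[[s,t]]`, the formal exponential `e ^ f` in `U(𝔤)[[s,t]]`. -/
def formalExp (𝔽 : Type*) {L : Type*} [Field 𝔽] [LieRing L] [LieAlgebra 𝔽 L] (f : Series L) :
    Series (UniversalEnvelopingAlgebra 𝔽 L) :=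
  expSeries 𝔽 (mapCoeff (UniversalEnvelopingAlgebra.ι 𝔽 : L →ₗ⁅𝔽⁆ UniversalEnvelopingAlgebra 𝔽 L).toLinearMap f)

end Exponential

/-- Formal words in two letters, built with a formal bracket and two formal projections. The letter
`minus` stands for `sh⁻` and the letter `plus` for `th⁺`. -/
inductive Word : Type
  | minus : Word
  | plus : Word
  | bracket : Word → Word → Word
  | projMinus : Word → Word
  | projPlus : Word → Word
  deriving DecidableEq

namespace Word

/-- The number of occurrences of the letter `minus`. -/
def countMinus : Word → ℕ
  | minus => 1
  | plus => 0
  | bracket v w => v.countMinus + w.countMinus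
  | projMinus w => w.countMinus
  | projPlus w => w.countMinus

/-- The number of occurrences of the letter `plus`. -/
def countPlus : Word → ℕ
  | minus => 0
  | plus => 1
  | bracket v w => v.countPlus + w.countPlus
  | projMinus w => w.countPlus
  | projPlus w => w.countPlus

/-- Words with at least three letters, including at least one of each kind. -/
def IsHigher (w : Word) : Prop :=
  3 ≤ w.countMinus + w.countPlus ∧ 1 ≤ w.countMinus ∧ 1 ≤ w.countPlus

/-- The value of a word in `𝔤[[s,t]]`: `minus` becomes `x`, `plus` becomes `y`, and `projMinus`,
`projPlus` become the coefficientwise extensions of the projections of `𝔤` onto `V`, `W` along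
`W`, `V`. -/
def eval {𝔽 L : Type*} [Field 𝔽] [LieRing L] [LieAlgebra 𝔽 L] {V W : Submodule 𝔽 L}
    (hVW : IsCompl V W) (x y : Series L) : Word → Series L
  | minus => x
  | plus => y
  | bracket v w => seriesBracket (v.eval hVW x y) (w.eval hVW x y)
  | projMinus w => mapCoeff (V.projection W hVW) (w.eval hVW x y)
  | projPlus w => mapCoeff (W.projection V hVW.symm) (w.eval hVW x y)

end Word

/-- Formal infinite linear combinations of words (a family of coefficients). As the formal
projections may be repeated, there are infinitely many words with a given number of each letter;
only finitely many of them may occur. -/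
def WordSeries (𝔽 : Type*) [Field 𝔽] : Submodule 𝔽 (Word → 𝔽) where
  carrier := {F | ∀ m n : ℕ, {w : Word | w.countMinus = m ∧ w.countPlus = n ∧ F w ≠ 0}.Finite}
  add_mem' {F G} hF hG m n := by
    refine ((hF m n).union (hG m n)).subset ?_
    rintro w ⟨h1, h2, h3⟩
    by_cases h : F w = 0
    · exact Or.inr ⟨h1, h2, fun h' => h3 (by rw [Pi.add_apply, h, h', add_zero])⟩
    · exact Or.inl ⟨h1, h2, h⟩
  zero_mem' m n := by
    refine Set.finite_empty.subset ?_
    rintro w ⟨_, _, h⟩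
    exact h rfl
  smul_mem' c F hF m n := by
    refine (hF m n).subset ?_
    rintro w ⟨h1, h2, h3⟩
    exact ⟨h1, h2, fun h => h3 (by rw [Pi.smul_apply, h, smul_zero])⟩

section Evaluation

variable {𝔽 L : Type*} [Field 𝔽] [LieRing L] [LieAlgebra 𝔽 L] {V W : Submodule 𝔽 L}

/-- The value in `𝔤[[s,t]]` of a formal linear combination of words, formed coefficient by
coefficient. It is meant for `x` divisible by `s` and `y` divisible by `t`: then only finitely many
words contribute to each coefficient, see `finite_support_evalSeries`. -/
def evalSeries (hVW : IsCompl V W) (x y : Series L) (F : WordSeries 𝔽) : Series L :=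
  fun d => ∑ᶠ w : Word, (F : Word → 𝔽) w • w.eval hVW x y d

/-- The formal completion `𝔽⟨⟨x, y; π^±⟩⟩`: all values in `𝔤[[s,t]]` of formal, possibly infinite,
linear combinations of words. -/
def completion (hVW : IsCompl V W) (x y : Series L) : Set (Series L) :=
  Set.range (evalSeries hVW x y)

theorem Word.eval_apply_eq_zero (hVW : IsCompl V W) {x y : Series L}
    (hx : ∀ d : Fin 2 →₀ ℕ, d 0 = 0 → x d = 0) (hy : ∀ d : Fin 2 →₀ ℕ, d 1 = 0 → y d = 0)
    (w : Word) (d : Fin 2 →₀ ℕ) (hd : d 0 < w.countMinus ∨ d 1 < w.countPlus) :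
    w.eval hVW x y d = 0 := by
  induction w generalizing d with
  | minus => exact hx d (by simp only [countMinus, countPlus] at hd; omega)
  | plus => exact hy d (by simp only [countMinus, countPlus] at hd; omega)
  | bracket v w ihv ihw =>
    refine Finset.sum_eq_zero fun p hp => ?_
    rw [Finset.HasAntidiagonal.mem_antidiagonal] at hp
    subst hp
    simp only [countMinus, countPlus, Finsupp.add_apply] at hd
    by_cases h : p.1 0 < v.countMinus ∨ p.1 1 < v.countPlus
    · rw [ihv _ h, zero_lie]
    · rw [ihw p.2 (by omega), lie_zero]
  | projMinus w ih =>
    change V.projection W hVW (w.eval hVW x y d) = 0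
    rw [ih d hd, map_zero]
  | projPlus w ih =>
    change W.projection V hVW.symm (w.eval hVW x y d) = 0
    rw [ih d hd, map_zero]

theorem finite_support_evalSeries (hVW : IsCompl V W) {x y : Series L}
    (hx : ∀ d : Fin 2 →₀ ℕ, d 0 = 0 → x d = 0) (hy : ∀ d : Fin 2 →₀ ℕ, d 1 = 0 → y d = 0)
    (F : WordSeries 𝔽) (d : Fin 2 →₀ ℕ) :
    (Function.support fun w : Word => (F : Word → 𝔽) w • w.eval hVW x y d).Finite := by
  refine (((Set.finite_Iic (d 0)).prod (Set.finite_Iic (d 1))).biUnion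
    fun p _ => F.2 p.1 p.2).subset fun w hw => ?_
  have h : ¬ (d 0 < w.countMinus ∨ d 1 < w.countPlus) := fun h =>
    hw (by simp only [Word.eval_apply_eq_zero hVW hx hy w d h, smul_zero])
  simp only [Set.mem_iUnion]
  refine ⟨(w.countMinus, w.countPlus), ⟨?_, ?_⟩, rfl, rfl, fun h0 => hw ?_⟩
  · exact not_lt.1 fun h' => h (Or.inl h')
  · exact not_lt.1 fun h' => h (Or.inr h')
  · simp only [h0, zero_smul]

end Evaluation

end FormalFactorization

end

open FormalFactorization

/-! Write x = sh⁻, y = th⁺, z = x + y. Existence comes from a differential equation in a central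
variable X that counts letters. One seeks e^α(X) e^β(X) = e^(Xz) with α = ∑ αₙXⁿ and β = ∑ βₙXⁿ
without constant terms. Let D = X d/dX and ψ(u) = (e^u - 1)/u. Comparing logarithmic derivatives, it
suffices that e^(-ad β) ψ(-ad α)(Dα) + ψ(-ad β)(Dβ) = Xz. In degree n this reads n(αₙ + βₙ) + rₙ =
δₙ₁ z, where rₙ is built by brackets from components of degree below n. Applying π⁻ and π⁺ separates
the two unknowns: nαₙ = δₙ₁ x - π⁻rₙ and nβₙ = δₙ₁ y - π⁺rₙ. This recursion makes sense for formal
words (`factors`), so the solution is independent of the Lie algebra. Every word of α contains the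
first letter and every word of β the second (`factors_mem`); hence the values are divisible by s and
by t, and the quotients are g⁻ and g⁺.

The identity is verified in U(𝔤)[[s,t]] modulo terms of degree at least K, for every K. There the
exponentials are finite sums and the differential equation can be solved coefficientwise
(`NilFiltration.truncExp_mul_truncExp`, `truncExp_factors`).

Uniqueness is an induction on the degree (`formalExp_mul_injective`). If two factorizations agree
below degree n, comparing terms of degree n shows that the differences of the two pairs of
logarithms add up to zero; these differences lie in complementary subspaces, so both vanish.
Descending from U(𝔤) to 𝔤 needs `ι_injective`, the part of Poincaré–Birkhoff–Witt proved here: 𝔤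
acts on the polynomials in the elements of an ordered basis, and a basis vector sends 1 to its own
variable. -/

noncomputable section

namespace FormalFactorization

/-! ### A faithful representation of a Lie algebra over a field -/

namespace PBW

theorem exists_min {I : Type*} [LinearOrder I] (M : Multiset I) (hM : M ≠ 0) :
    ∃ k ∈ M, ∀ m ∈ M, k ≤ m := by
  obtain ⟨k, hk, h⟩ := M.toFinset.exists_min_image id
    (by rwa [Finset.nonempty_iff_ne_empty, Ne, Multiset.toFinset_eq_empty])
  exact ⟨k, by simpa using hk, fun m hm => h m (by simpa using hm)⟩

variable {𝕜 L I : Type*} [Field 𝕜] [LieRing L] [LieAlgebra 𝕜 L]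

/-- The multisets over `I` are a basis of the polynomials in variables indexed by `I`. -/
abbrev Mono (𝕜 : Type*) [Field 𝕜] {I : Type*} (M : Multiset I) : Multiset I →₀ 𝕜 :=
  Finsupp.single M 1

/-- The polynomials of degree less than `n`. -/
abbrev degLT (𝕜 I : Type*) [Field 𝕜] (n : ℕ) : Submodule 𝕜 (Multiset I →₀ 𝕜) :=
  Finsupp.supported 𝕜 𝕜 {M | M.card < n}

theorem mono_mem {M : Multiset I} {n : ℕ} (h : M.card < n) : Mono 𝕜 M ∈ degLT 𝕜 I n :=
  Finsupp.single_mem_supported 𝕜 1 h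

theorem degLT_mono {m n : ℕ} (h : m ≤ n) : degLT 𝕜 I m ≤ degLT 𝕜 I n :=
  Finsupp.supported_mono fun _ hM => lt_of_lt_of_le hM h

/-- A linear condition holds on `degLT 𝕜 I n` if it holds on monomials. -/
theorem degLT_induction {n : ℕ} {p : (Multiset I →₀ 𝕜) → Prop} (V : Submodule 𝕜 (Multiset I →₀ 𝕜))
    (hV : ∀ v, v ∈ V ↔ p v) (h : ∀ M : Multiset I, M.card < n → p (Mono 𝕜 M))
    {v : Multiset I →₀ 𝕜} (hv : v ∈ degLT 𝕜 I n) : p v := by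
  rw [← hV]
  rw [degLT, Finsupp.supported_eq_span_single] at hv
  refine Submodule.span_le.2 ?_ hv
  rintro _ ⟨M, hM, rfl⟩
  exact (hV _).2 (h M hM)

/-- Two bilinear actions agree on polynomials of degree less than `n` if they agree on basis
vectors. -/
theorem eq_of_basis {N : Type*} [AddCommGroup N] [Module 𝕜 N] (b : Module.Basis I 𝕜 L)
    {f g : L →ₗ[𝕜] (Multiset I →₀ 𝕜) →ₗ[𝕜] N} {n : ℕ}
    (h : ∀ i M, M.card < n → f (b i) (Mono 𝕜 M) = g (b i) (Mono 𝕜 M)) (x : L)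
    {v : Multiset I →₀ 𝕜} (hv : v ∈ degLT 𝕜 I n) : f x v = g x v := by
  refine degLT_induction (p := fun v => f x v = g x v) (LinearMap.eqLocus (f x) (g x))
    (fun _ => Iff.rfl) (fun M hM => ?_) hv
  have : f.flip (Mono 𝕜 M) = g.flip (Mono 𝕜 M) := b.ext fun i => h i M hM
  exact LinearMap.congr_fun this x

theorem mem_of_basis (b : Module.Basis I 𝕜 L)
    {f : L →ₗ[𝕜] (Multiset I →₀ 𝕜) →ₗ[𝕜] (Multiset I →₀ 𝕜)} {n : ℕ}
    {V : Submodule 𝕜 (Multiset I →₀ 𝕜)}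
    (h : ∀ i M, M.card < n → f (b i) (Mono 𝕜 M) ∈ V) (x : L)
    {v : Multiset I →₀ 𝕜} (hv : v ∈ degLT 𝕜 I n) : f x v ∈ V := by
  have h0 := eq_of_basis b (f := f.compr₂ V.mkQ) (g := 0) (n := n)
    (fun i M hM => by simpa using h i M hM) x hv
  simpa using h0

variable [LinearOrder I]

open Classical in
/-- The action of the basis vector `b i` on the monomial `M`, given an action `f` that is correct on
monomials of lower degree. -/
def stepFun (b : Module.Basis I 𝕜 L)
    (f : L →ₗ[𝕜] (Multiset I →₀ 𝕜) →ₗ[𝕜] (Multiset I →₀ 𝕜)) (i : I) (M : Multiset I) :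
    Multiset I →₀ 𝕜 :=
  if h : M ≠ 0 ∧ ∃ m ∈ M, m < i then
    let k := (exists_min M h.1).choose
    Mono 𝕜 (i ::ₘ M) + f (b k) (f (b i) (Mono 𝕜 (M.erase k)) - Mono 𝕜 (i ::ₘ M.erase k)) +
      f ⁅b i, b k⁆ (Mono 𝕜 (M.erase k))
  else Mono 𝕜 (i ::ₘ M)

/-- The action of `L` on polynomials, correct on monomials of degree less than `n`. -/
def act (b : Module.Basis I 𝕜 L) : ℕ → L →ₗ[𝕜] (Multiset I →₀ 𝕜) →ₗ[𝕜] (Multiset I →₀ 𝕜)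
  | 0 => 0
  | n + 1 => b.constr 𝕜 fun i => Finsupp.linearCombination 𝕜 (stepFun b (act b n) i)

theorem act_succ (b : Module.Basis I 𝕜 L) (n : ℕ) (i : I) (M : Multiset I) :
    act b (n + 1) (b i) (Mono 𝕜 M) = stepFun b (act b n) i M := by
  simp [act, Module.Basis.constr_basis]

theorem stepFun_of_le (b : Module.Basis I 𝕜 L)
    (f : L →ₗ[𝕜] (Multiset I →₀ 𝕜) →ₗ[𝕜] (Multiset I →₀ 𝕜)) {i : I} {M : Multiset I}
    (h : ∀ m ∈ M, i ≤ m) : stepFun b f i M = Mono 𝕜 (i ::ₘ M) := by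
  rw [stepFun, dif_neg]
  rintro ⟨_, m, hm, hi⟩
  exact absurd (h m hm) (not_le.2 hi)

theorem stepFun_cons (b : Module.Basis I 𝕜 L)
    (f : L →ₗ[𝕜] (Multiset I →₀ 𝕜) →ₗ[𝕜] (Multiset I →₀ 𝕜)) {i k : I} {N : Multiset I}
    (hk : ∀ m ∈ N, k ≤ m) (hi : k < i) :
    stepFun b f i (k ::ₘ N) = Mono 𝕜 (i ::ₘ k ::ₘ N) +
      f (b k) (f (b i) (Mono 𝕜 N) - Mono 𝕜 (i ::ₘ N)) + f ⁅b i, b k⁆ (Mono 𝕜 N) := by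
  have h : k ::ₘ N ≠ 0 ∧ ∃ m ∈ k ::ₘ N, m < i :=
    ⟨Multiset.cons_ne_zero, k, Multiset.mem_cons_self _ _, hi⟩
  have hc := (exists_min (k ::ₘ N) h.1).choose_spec
  have hk' : (exists_min (k ::ₘ N) h.1).choose = k := by
    refine le_antisymm (hc.2 k (Multiset.mem_cons_self _ _)) ?_
    rcases Multiset.mem_cons.1 hc.1 with h | h
    · exact h.ge
    · exact hk _ h
  rw [stepFun, dif_pos h]
  simp only [hk', Multiset.erase_cons_head]

/-- Every multiset is either bounded below by `i` or has a least element, which is below `i`. -/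
theorem le_or_cons (i : I) (M : Multiset I) :
    (∀ m ∈ M, i ≤ m) ∨ ∃ k N, M = k ::ₘ N ∧ (∀ m ∈ N, k ≤ m) ∧ k < i := by
  by_cases h : ∀ m ∈ M, i ≤ m
  · exact Or.inl h
  · push Not at h
    obtain ⟨m, hm, hi⟩ := h
    obtain ⟨k, hk, hmin⟩ := exists_min M (by rintro rfl; simp at hm)
    refine Or.inr ⟨k, M.erase k, (Multiset.cons_erase hk).symm,
      fun x hx => hmin x (Multiset.mem_of_mem_erase hx), (hmin m hm).trans_lt hi⟩

/-- Multiplication by the variable is the leading term of the action. Both corrections in the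
recursion apply one Lie algebra element to a polynomial of degree at most that of `N`, so they do
not exceed the degree of `k ::ₘ N`. -/
theorem act_sub_mem (b : Module.Basis I 𝕜 L) (n : ℕ) (i : I) (M : Multiset I) (hM : M.card < n) :
    act b n (b i) (Mono 𝕜 M) - Mono 𝕜 (i ::ₘ M) ∈ degLT 𝕜 I (M.card + 1) := by
  induction n generalizing i M with
  | zero => omega
  | succ n ih =>
    have key : ∀ x : L, ∀ m ≤ n, ∀ v ∈ degLT 𝕜 I m, act b n x v ∈ degLT 𝕜 I (m + 1) := by
      intro x m hm v hv
      refine mem_of_basis b (fun i M hM => ?_) x hv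
      have h := add_mem (degLT_mono (by omega : M.card + 1 ≤ m + 1) (ih i M (by omega)))
        (mono_mem (𝕜 := 𝕜) (M := i ::ₘ M) (n := m + 1) (by simpa using hM))
      simpa using h
    rw [act_succ]
    rcases le_or_cons i M with h | ⟨k, N, rfl, hk, hi⟩
    · rw [stepFun_of_le b _ h, sub_self]
      exact zero_mem _
    · rw [stepFun_cons b _ hk hi]
      rw [Multiset.card_cons] at hM ⊢
      have h1 := key (b k) (N.card + 1) (by omega) _ (ih i N (by omega))
      have h2 := key ⁅b i, b k⁆ (N.card + 1) (by omega) (Mono 𝕜 N) (mono_mem (by omega))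
      convert add_mem h1 h2 using 1
      abel

theorem act_mem (b : Module.Basis I 𝕜 L) {m n : ℕ} (hm : m ≤ n) (x : L) {v : Multiset I →₀ 𝕜}
    (hv : v ∈ degLT 𝕜 I m) : act b n x v ∈ degLT 𝕜 I (m + 1) := by
  refine mem_of_basis b (fun i M hM => ?_) x hv
  have h := add_mem (degLT_mono (by omega : M.card + 1 ≤ m + 1) (act_sub_mem b n i M (by omega)))
    (mono_mem (𝕜 := 𝕜) (M := i ::ₘ M) (n := m + 1) (by simpa using hM))
  simpa using h

/-- On `k ::ₘ N` the recursion evaluates the previous action only at `N` and at the error term of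
`act_sub_mem`, both of smaller degree than `k ::ₘ N`. -/
theorem act_stable (b : Module.Basis I 𝕜 L) (n : ℕ) (x : L) {v : Multiset I →₀ 𝕜}
    (hv : v ∈ degLT 𝕜 I n) : act b (n + 1) x v = act b n x v := by
  induction n generalizing x v with
  | zero =>
    have : v = 0 := by simpa [degLT] using hv
    simp [this]
  | succ n ih =>
    refine eq_of_basis b (fun i M hM => ?_) x hv
    rw [act_succ, act_succ]
    rcases le_or_cons i M with h | ⟨k, N, rfl, hk, hi⟩
    · rw [stepFun_of_le b _ h, stepFun_of_le b _ h]
    · rw [stepFun_cons b _ hk hi, stepFun_cons b _ hk hi]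
      rw [Multiset.card_cons] at hM
      have hN : Mono 𝕜 N ∈ degLT 𝕜 I n := mono_mem (by omega)
      rw [ih _ hN, ih _ hN, ih]
      exact degLT_mono (by omega) (act_sub_mem b n i N (by omega))

theorem act_eq (b : Module.Basis I 𝕜 L) {m n : ℕ} (hm : m ≤ n) (x : L) {v : Multiset I →₀ 𝕜}
    (hv : v ∈ degLT 𝕜 I m) : act b n x v = act b m x v := by
  induction n, hm using Nat.le_induction with
  | base => rfl
  | succ n hn ih => rw [act_stable b n x (degLT_mono hn hv), ih]

/-- The action of `L` on polynomials. -/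
def rho (b : Module.Basis I 𝕜 L) : L →ₗ[𝕜] (Multiset I →₀ 𝕜) →ₗ[𝕜] (Multiset I →₀ 𝕜) :=
  b.constr 𝕜 fun i => Finsupp.linearCombination 𝕜 fun M => act b (M.card + 1) (b i) (Mono 𝕜 M)

theorem rho_eq_act (b : Module.Basis I 𝕜 L) {n : ℕ} (x : L) {v : Multiset I →₀ 𝕜}
    (hv : v ∈ degLT 𝕜 I n) : rho b x v = act b n x v := by
  refine eq_of_basis b (fun i M hM => ?_) x hv
  have : rho b (b i) (Mono 𝕜 M) = act b (M.card + 1) (b i) (Mono 𝕜 M) := by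
    simp [rho, Module.Basis.constr_basis]
  rw [this, act_eq b (by omega : M.card + 1 ≤ n) _ (mono_mem (by omega))]

theorem rho_of_le (b : Module.Basis I 𝕜 L) {i : I} {M : Multiset I} (h : ∀ m ∈ M, i ≤ m) :
    rho b (b i) (Mono 𝕜 M) = Mono 𝕜 (i ::ₘ M) := by
  rw [rho_eq_act b _ (mono_mem (Nat.lt_succ_self _)), act_succ, stepFun_of_le b _ h]

theorem rho_sub_mem (b : Module.Basis I 𝕜 L) (i : I) (M : Multiset I) :
    rho b (b i) (Mono 𝕜 M) - Mono 𝕜 (i ::ₘ M) ∈ degLT 𝕜 I (M.card + 1) := by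
  rw [rho_eq_act b _ (mono_mem (Nat.lt_succ_self _))]
  exact act_sub_mem b _ i M (Nat.lt_succ_self _)

/-- This is the relation that the recursion was designed to satisfy: `b k` acts on `N` and on `i ::ₘ
N` as plain multiplication, so the definition on `k ::ₘ N` is the commutation rule rearranged. -/
theorem rho_comm_of_le (b : Module.Basis I 𝕜 L) {i k : I} {N : Multiset I}
    (hk : ∀ m ∈ N, k ≤ m) (hi : k < i) :
    rho b (b i) (rho b (b k) (Mono 𝕜 N)) =
      rho b (b k) (rho b (b i) (Mono 𝕜 N)) + rho b ⁅b i, b k⁆ (Mono 𝕜 N) := by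
  have hN : Mono 𝕜 N ∈ degLT 𝕜 I (N.card + 1) := mono_mem (by omega)
  have hkN : Mono 𝕜 (k ::ₘ N) ∈ degLT 𝕜 I (N.card + 1 + 1) := mono_mem (by simp)
  have hik : ∀ m ∈ i ::ₘ N, k ≤ m := by
    intro m hm
    rcases Multiset.mem_cons.1 hm with rfl | hm
    · exact hi.le
    · exact hk m hm
  rw [rho_of_le b hk, rho_eq_act b _ hkN, act_succ, stepFun_cons b _ hk hi,
    ← rho_eq_act b _ hN, ← rho_eq_act b _ hN, ← rho_eq_act b _ (rho_sub_mem b i N), map_sub,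
    rho_of_le b hik, Multiset.cons_swap]
  abel

/-- Induction on the degree. For basis vectors `j < i`, the case not covered by `rho_comm_of_le` is
a monomial `k ::ₘ N` with `k < j`. It equals `b k` applied to `N`; after moving `b k` to the left
past both others, the remaining terms match by induction on `N` and the Jacobi identity. -/
theorem rho_comm (b : Module.Basis I 𝕜 L) (n : ℕ) (x y : L) {v : Multiset I →₀ 𝕜}
    (hv : v ∈ degLT 𝕜 I n) :
    rho b x (rho b y v) = rho b y (rho b x v) + rho b ⁅x, y⁆ v := by
  induction n generalizing x y v with
  | zero =>
    have : v = 0 := by simpa [degLT] using hv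
    simp [this]
  | succ n ih =>
    have basis : ∀ i j M, M.card < n + 1 → rho b (b i) (rho b (b j) (Mono 𝕜 M)) =
        rho b (b j) (rho b (b i) (Mono 𝕜 M)) + rho b ⁅b i, b j⁆ (Mono 𝕜 M) := by
      have lt : ∀ i j M, j < i → M.card < n + 1 → rho b (b i) (rho b (b j) (Mono 𝕜 M)) =
          rho b (b j) (rho b (b i) (Mono 𝕜 M)) + rho b ⁅b i, b j⁆ (Mono 𝕜 M) := by
        intro i j M hij hM
        rcases le_or_cons j M with h | ⟨k, N, rfl, hk, hj⟩
        · exact rho_comm_of_le b h hij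
        · rw [Multiset.card_cons] at hM
          have hN : Mono 𝕜 N ∈ degLT 𝕜 I n := mono_mem (by omega)
          -- `b q` applied to `N` is `q ::ₘ N` plus an error of smaller degree: `rho_comm_of_le`
          -- handles the former, the induction hypothesis the latter.
          have three : ∀ p q, k < p → k < q →
              rho b (b p) (rho b (b k) (rho b (b q) (Mono 𝕜 N))) =
              rho b (b k) (rho b (b p) (rho b (b q) (Mono 𝕜 N))) +
                rho b ⁅b p, b k⁆ (rho b (b q) (Mono 𝕜 N)) := by
            intro p q hp hq
            have h1 := ih (b p) (b k) (degLT_mono (by omega) (rho_sub_mem b q N))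
            have h2 := rho_comm_of_le b (N := q ::ₘ N) (k := k) (i := p) (fun m hm => by
              rcases Multiset.mem_cons.1 hm with rfl | hm
              · exact hq.le
              · exact hk m hm) hp
            simp only [map_sub] at h1
            linear_combination (norm := module) h1 + h2
          rw [← rho_of_le b hk, rho_comm_of_le b hk hj, rho_comm_of_le b hk (hj.trans hij), map_add,
            map_add, three i j (hj.trans hij) hj, three j i hj (hj.trans hij),
            ih (b i) (b j) hN, ih (b i) ⁅b j, b k⁆ hN, ih (b j) ⁅b i, b k⁆ hN,
            ih ⁅b i, b j⁆ (b k) hN, leibniz_lie (b i) (b j) (b k)]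
          simp only [map_add, LinearMap.add_apply]
          abel
      intro i j M hM
      rcases lt_trichotomy i j with h | rfl | h
      · rw [lt j i M h hM, ← lie_skew (b i) (b j), map_neg, LinearMap.neg_apply]
        abel
      · simp
      · exact lt i j M h hM
    have hM : ∀ M : Multiset I, M.card < n + 1 → rho b x (rho b y (Mono 𝕜 M)) =
        rho b y (rho b x (Mono 𝕜 M)) + rho b ⁅x, y⁆ (Mono 𝕜 M) := by
      intro M hM
      let R := rho b
      let e : (Multiset I →₀ 𝕜) := Mono 𝕜 M
      let B1 : L →ₗ[𝕜] L →ₗ[𝕜] (Multiset I →₀ 𝕜) :=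
        LinearMap.mk₂ 𝕜 (fun x y => R x (R y e)) (by simp) (by simp) (by simp) (by simp)
      let B2 : L →ₗ[𝕜] L →ₗ[𝕜] (Multiset I →₀ 𝕜) :=
        LinearMap.mk₂ 𝕜 (fun x y => R y (R x e) + R ⁅x, y⁆ e)
          (by intros; simp only [map_add, LinearMap.add_apply, add_lie]; abel)
          (by intros; simp) (by intros; simp only [map_add, LinearMap.add_apply, lie_add]; abel)
          (by intros; simp)
      have : B1 = B2 := b.ext fun i => b.ext fun j => basis i j M hM
      exact congr($this x y)
    refine degLT_induction (p := fun v => rho b x (rho b y v) =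
        rho b y (rho b x v) + rho b ⁅x, y⁆ v)
      (LinearMap.eqLocus (rho b x ∘ₗ rho b y) (rho b y ∘ₗ rho b x + rho b ⁅x, y⁆))
      (fun _ => Iff.rfl) hM hv

end PBW

section

attribute [local instance 100] LieRing.ofAssociativeRing

/-- A Lie algebra over a field embeds into its universal enveloping algebra. -/
theorem ι_injective (𝕜 : Type*) {L : Type*} [Field 𝕜] [LieRing L] [LieAlgebra 𝕜 L] :
    Function.Injective (UniversalEnvelopingAlgebra.ι 𝕜 : L →ₗ⁅𝕜⁆ UniversalEnvelopingAlgebra 𝕜 L) := by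
  let b := Module.Basis.ofVectorSpace 𝕜 L
  classical
  let _ : LinearOrder (Module.Basis.ofVectorSpaceIndex 𝕜 L) := linearOrderOfSTO WellOrderingRel
  let r : L →ₗ⁅𝕜⁆ Module.End 𝕜 (Multiset (Module.Basis.ofVectorSpaceIndex 𝕜 L) →₀ 𝕜) :=
    { PBW.rho b with
      map_lie' := by
        intro x y
        refine Finsupp.lhom_ext' fun M => LinearMap.ext_ring ?_
        have := PBW.rho_comm b (M.card + 1) x y (PBW.mono_mem (𝕜 := 𝕜) (Nat.lt_succ_self M.card))
        simp only [LieRing.of_associative_ring_bracket]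
        exact eq_sub_of_add_eq' this.symm }
  have hr : Function.Injective r := by
    rw [← LieHom.coe_toLinearMap, ← LinearMap.ker_eq_bot, LinearMap.ker_eq_bot']
    intro x hx
    -- Acting on the constant polynomial 1 recovers the coordinates of `x` as a linear polynomial.
    have h0 : PBW.rho b x (PBW.Mono 𝕜 0) = 0 := congr($hx _)
    have h1 : (PBW.rho b).flip (PBW.Mono 𝕜 0) =
        Finsupp.lmapDomain 𝕜 𝕜 (fun i => ({i} : Multiset _)) ∘ₗ b.repr.toLinearMap := by
      refine b.ext fun i => ?_
      have := PBW.rho_of_le b (i := i) (M := 0) (by simp)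
      simpa using this
    have h2 : Finsupp.mapDomain (fun i => ({i} : Multiset _)) (b.repr x) = 0 := by
      rw [← h0]
      exact congr($h1.symm x)
    have h3 := Finsupp.mapDomain_injective (fun _ _ h => Multiset.singleton_inj.1 h)
      (h2.trans Finsupp.mapDomain_zero.symm)
    simpa using h3
  intro x y hxy
  apply hr
  rw [← UniversalEnvelopingAlgebra.lift_ι_apply 𝕜 r x, hxy,
    UniversalEnvelopingAlgebra.lift_ι_apply 𝕜 r y]

end

/-! ### Truncated exponentials in an associative algebra -/

section TruncExp

variable {𝕜 P : Type*} [Field 𝕜] [Ring P] [Algebra 𝕜 P]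

/-- The exponential series of `a`, truncated after `K` terms. -/
def truncExp (𝕜 : Type*) {P : Type*} [Field 𝕜] [Ring P] [Algebra 𝕜 P] (K : ℕ) (a : P) : P :=
  ∑ k ∈ Finset.range K, ((k.factorial : 𝕜)⁻¹) • a ^ k

/-- The linear map `c ↦ c * a - a * c`. -/
def negAd (𝕜 : Type*) {P : Type*} [Field 𝕜] [Ring P] [Algebra 𝕜 P] (a : P) : P →ₗ[𝕜] P :=
  LinearMap.mulRight 𝕜 a - LinearMap.mulLeft 𝕜 a

theorem negAd_apply (a c : P) : negAd 𝕜 a c = c * a - a * c := rfl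

/-- Right multiplication by `a` is the sum of the commuting operators `negAd 𝕜 a` and left
multiplication by `a`; expand its power by the binomial theorem. -/
theorem mul_pow_eq_sum (a c : P) (n : ℕ) :
    c * a ^ n = ∑ m ∈ Finset.range (n + 1), n.choose m • (a ^ (n - m) * (negAd 𝕜 a ^ m) c) := by
  have hc : Commute (negAd 𝕜 a) (LinearMap.mulLeft 𝕜 a) := by
    refine LinearMap.ext fun c => ?_
    simp [negAd_apply, mul_sub, mul_assoc]
  have h := congr($(hc.add_pow n) c)
  rw [negAd, sub_add_cancel, LinearMap.pow_mulRight, LinearMap.mulRight_apply] at h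
  rw [h, LinearMap.sum_apply]
  refine Finset.sum_congr rfl fun m _ => ?_
  have hc' : Commute (negAd 𝕜 a ^ m) (LinearMap.mulLeft 𝕜 a ^ (n - m)) := hc.pow_pow _ _
  change ((negAd 𝕜 a ^ m * LinearMap.mulLeft 𝕜 a ^ (n - m)) * (n.choose m : Module.End 𝕜 P)) c = _
  rw [hc'.eq, ← Nat.cast_comm, ← nsmul_eq_mul, LinearMap.smul_apply, Module.End.mul_apply,
    LinearMap.pow_mulLeft, LinearMap.mulLeft_apply]

/-- The Leibniz rule produces `D a * a ^ (n + 1)`; moving `D a` to the right by `mul_pow_eq_sum`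
makes the coefficients add up by Pascal's rule. -/
theorem map_pow_succ_eq_sum (D : P →ₗ[𝕜] P) (hD : ∀ x y, D (x * y) = D x * y + x * D y) (a : P)
    (n : ℕ) : D (a ^ (n + 1)) =
      ∑ m ∈ Finset.range (n + 1), (n + 1).choose (m + 1) • (a ^ (n - m) * (negAd 𝕜 a ^ m) (D a)) := by
  induction n with
  | zero => simp
  | succ n ih =>
    rw [pow_succ' a (n + 1), hD, ih, mul_pow_eq_sum (𝕜 := 𝕜) a (D a) (n + 1), Finset.mul_sum]
    have h : ∑ m ∈ Finset.range (n + 1),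
        a * ((n + 1).choose (m + 1) • (a ^ (n - m) * (negAd 𝕜 a ^ m) (D a))) =
        ∑ m ∈ Finset.range (n + 1 + 1),
          (n + 1).choose (m + 1) • (a ^ (n + 1 - m) * (negAd 𝕜 a ^ m) (D a)) := by
      rw [Finset.sum_range_succ _ (n + 1), Nat.choose_succ_self, zero_smul, add_zero]
      refine Finset.sum_congr rfl fun m hm => ?_
      have : n + 1 - m = n - m + 1 := by have := Finset.mem_range.1 hm; omega
      rw [this, pow_succ', mul_smul_comm, mul_assoc]
    rw [h, ← Finset.sum_add_distrib]
    refine Finset.sum_congr rfl fun m _ => ?_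
    rw [← add_smul, Nat.choose_succ_succ (n + 1) m]

/-- Cauchy product: the triangle and the square differ only by indices with `K ≤ p + m`, where
nilpotency will make the terms vanish. -/
theorem sum_range_mul_range_eq {M : Type*} [AddCommMonoid M] (f : ℕ → ℕ → M) (K : ℕ)
    (hf : ∀ p m, K ≤ p + m → f p m = 0) :
    ∑ n ∈ Finset.range K, ∑ m ∈ Finset.range (n + 1), f (n - m) m =
      ∑ p ∈ Finset.range K, ∑ m ∈ Finset.range K, f p m := by
  rw [Finset.sum_sigma', Finset.sum_comm, Finset.sum_sigma']
  refine Finset.sum_bij_ne_zero (fun x _ _ => ⟨x.2, x.1 - x.2⟩) ?_ ?_ ?_ ?_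
  · rintro ⟨n, m⟩ h _
    simp only [Finset.mem_sigma, Finset.mem_range] at h ⊢
    omega
  · rintro ⟨n, m⟩ h _ ⟨n', m'⟩ h' _ he
    simp only [Finset.mem_sigma, Finset.mem_range, Sigma.mk.injEq, heq_eq_eq] at h h' he ⊢
    omega
  · rintro ⟨m, p⟩ h hne
    have hlt : p + m < K := by
      by_contra hc
      exact hne (hf p m (not_lt.1 hc))
    refine ⟨⟨p + m, m⟩, ?_, ?_, ?_⟩
    · simp only [Finset.mem_sigma, Finset.mem_range]
      omega
    · simpa using hne
    · simp
  · rintro ⟨n, m⟩ h _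
    rfl

variable [CharZero 𝕜]

theorem choose_factorial_inv (n m : ℕ) (hm : m ≤ n) :
    (n.factorial : 𝕜)⁻¹ * (n.choose m : 𝕜) = ((n - m).factorial : 𝕜)⁻¹ * (m.factorial : 𝕜)⁻¹ := by
  have h0 : ∀ k : ℕ, (k.factorial : 𝕜) ≠ 0 := fun k => Nat.cast_ne_zero.2 k.factorial_ne_zero
  have h := congrArg (Nat.cast : ℕ → 𝕜) (Nat.choose_mul_factorial_mul_factorial hm)
  push_cast at h
  have := h0 n; have := h0 m; have := h0 (n - m)
  field_simp
  linear_combination h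

/-- Moving an exponential to the left: `c * e ^ a = e ^ a * (e ^ (-ad a) c)`. -/
theorem mul_truncExp (K : ℕ) (a c : P) (h : ∀ p m, K ≤ p + m → a ^ p * (negAd 𝕜 a ^ m) c = 0) :
    c * truncExp 𝕜 K a = truncExp 𝕜 K a *
      ∑ m ∈ Finset.range K, ((m.factorial : 𝕜)⁻¹) • (negAd 𝕜 a ^ m) c := by
  rw [truncExp, Finset.sum_mul_sum, Finset.mul_sum]
  have hs := sum_range_mul_range_eq (fun p m => ((p.factorial : 𝕜)⁻¹ • a ^ p) *
    ((m.factorial : 𝕜)⁻¹ • (negAd 𝕜 a ^ m) c)) K (fun p m hpm => by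
      rw [smul_mul_smul_comm, h p m hpm, smul_zero])
  rw [← hs]
  refine Finset.sum_congr rfl fun n _ => ?_
  rw [mul_smul_comm, mul_pow_eq_sum (𝕜 := 𝕜), Finset.smul_sum]
  refine Finset.sum_congr rfl fun m hm => ?_
  rw [smul_mul_smul_comm, ← choose_factorial_inv n m (by simpa [Nat.lt_succ_iff] using hm),
    mul_smul, Nat.cast_smul_eq_nsmul]

/-- The derivative of the exponential: `D (e ^ a) = e ^ a * ((1 - e ^ (-ad a)) / ad a) (D a)`. -/
theorem map_truncExp (D : P →ₗ[𝕜] P) (hD : ∀ x y, D (x * y) = D x * y + x * D y) (K : ℕ) (a : P)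
    (hK : a ^ K = 0) (h : ∀ p m, K ≤ p + m → a ^ p * (negAd 𝕜 a ^ m) (D a) = 0) :
    D (truncExp 𝕜 K a) = truncExp 𝕜 K a *
      ∑ m ∈ Finset.range K, (((m + 1).factorial : 𝕜)⁻¹) • (negAd 𝕜 a ^ m) (D a) := by
  have hD1 : D 1 = 0 := by simpa using hD 1 1
  have h1 : truncExp 𝕜 K a = truncExp 𝕜 (K + 1) a := by
    rw [truncExp, truncExp, Finset.sum_range_succ, hK, smul_zero, add_zero]
  have h2 : D (truncExp 𝕜 K a) =
      ∑ n ∈ Finset.range K, ((n + 1).factorial : 𝕜)⁻¹ • D (a ^ (n + 1)) := by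
    rw [h1, truncExp, map_sum, Finset.sum_range_succ']
    simp [hD1]
  rw [h2, truncExp, Finset.sum_mul_sum]
  have hs := sum_range_mul_range_eq (fun p m => ((p.factorial : 𝕜)⁻¹ • a ^ p) *
    (((m + 1).factorial : 𝕜)⁻¹ • (negAd 𝕜 a ^ m) (D a))) K (fun p m hpm => by
      rw [smul_mul_smul_comm, h p m hpm, smul_zero])
  rw [← hs]
  refine Finset.sum_congr rfl fun n _ => ?_
  rw [map_pow_succ_eq_sum D hD, Finset.smul_sum]
  refine Finset.sum_congr rfl fun m hm => ?_
  have hm' : m ≤ n := by simpa [Nat.lt_succ_iff] using hm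
  have hc := choose_factorial_inv (𝕜 := 𝕜) (n + 1) (m + 1) (by omega)
  rw [Nat.add_sub_add_right] at hc
  rw [smul_mul_smul_comm, ← hc, mul_smul, Nat.cast_smul_eq_nsmul]

end TruncExp

/-! ### Exponentials of polynomials with coefficients in a nilpotent filtered algebra -/

section Filtered

open Polynomial

variable {𝕜 Q : Type*} [Field 𝕜] [Ring Q] [Algebra 𝕜 Q]

/-- Polynomials all of whose coefficients lie in a subspace. -/
def coeffsIn (V : Submodule 𝕜 Q) : Submodule 𝕜 Q[X] where
  carrier := {p | ∀ n, p.coeff n ∈ V}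
  add_mem' hp hq n := by rw [coeff_add]; exact V.add_mem (hp n) (hq n)
  zero_mem' n := by rw [coeff_zero]; exact V.zero_mem
  smul_mem' c p hp n := by rw [coeff_smul]; exact V.smul_mem c (hp n)

/-- The derivation `X * d/dX` of the polynomials over a not necessarily commutative ring. -/
def euler (𝕜 : Type*) {Q : Type*} [Field 𝕜] [Ring Q] [Algebra 𝕜 Q] : Q[X] →ₗ[𝕜] Q[X] where
  toFun p := X * derivative p
  map_add' p q := by rw [derivative_add, mul_add]
  map_smul' c p := by rw [derivative_smul, mul_smul_comm, RingHom.id_apply]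

theorem coeff_euler (p : Q[X]) (n : ℕ) : (euler 𝕜 p).coeff n = (n : 𝕜) • p.coeff n := by
  change (X * derivative p).coeff n = _
  cases n with
  | zero => simp
  | succ n =>
    rw [coeff_X_mul, coeff_derivative, Nat.cast_smul_eq_nsmul, nsmul_eq_mul', Nat.cast_succ]

theorem euler_mul (p q : Q[X]) : euler 𝕜 (p * q) = euler 𝕜 p * q + p * euler 𝕜 q := by
  change X * derivative (p * q) = X * derivative p * q + p * (X * derivative q)
  rw [derivative_mul, mul_add, mul_assoc, ← mul_assoc p X, ← X_mul, mul_assoc]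

/-- A decreasing multiplicative filtration that vanishes from index `K` on. -/
structure NilFiltration (J : ℕ → Submodule 𝕜 Q) (K : ℕ) : Prop where
  top : J 0 = ⊤
  anti : Antitone J
  mul : ∀ i j, ∀ x ∈ J i, ∀ y ∈ J j, x * y ∈ J (i + j)
  bot : J K = ⊥

namespace NilFiltration

variable {J : ℕ → Submodule 𝕜 Q} {K : ℕ} (hJ : NilFiltration J K)
include hJ

theorem polynomial : NilFiltration (fun k => coeffsIn (J k)) K where
  top := by
    refine eq_top_iff.2 fun p _ n => ?_
    rw [hJ.top]
    trivial
  anti i j h p hp n := hJ.anti h (hp n)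
  mul i j p hp q hq n := by
    rw [coeff_mul]
    exact sum_mem fun x _ => hJ.mul i j _ (hp _) _ (hq _)
  bot := by
    refine eq_bot_iff.2 fun p hp => ?_
    ext n
    have := hp n
    rw [hJ.bot] at this
    simpa using this

theorem pow_mem {x : Q} (hx : x ∈ J 1) (n : ℕ) : x ^ n ∈ J n := by
  induction n with
  | zero => rw [hJ.top]; trivial
  | succ n ih => exact pow_succ x n ▸ hJ.mul n 1 _ ih _ hx

theorem negAd_pow_mem {x : Q} (hx : x ∈ J 1) (c : Q) (n : ℕ) : (negAd 𝕜 x ^ n) c ∈ J n := by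
  induction n with
  | zero => rw [hJ.top]; trivial
  | succ n ih =>
    rw [pow_succ', Module.End.mul_apply, negAd_apply]
    refine sub_mem (hJ.mul n 1 _ ih _ hx) ?_
    rw [add_comm]
    exact hJ.mul 1 n _ hx _ ih

theorem eq_zero {x : Q} {n : ℕ} (hn : K ≤ n) (hx : x ∈ J n) : x = 0 := by
  have := hJ.anti hn hx
  rwa [hJ.bot] at this

theorem pow_eq_zero {x : Q} (hx : x ∈ J 1) {n : ℕ} (hn : K ≤ n) : x ^ n = 0 :=
  hJ.eq_zero hn (hJ.pow_mem hx n)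

theorem pow_mul_negAd_pow_eq_zero {x : Q} (hx : x ∈ J 1) (c : Q) (p m : ℕ) (h : K ≤ p + m) :
    x ^ p * (negAd 𝕜 x ^ m) c = 0 :=
  hJ.eq_zero h (hJ.mul p m _ (hJ.pow_mem hx p) _ (hJ.negAd_pow_mem hx c m))

/-- If the logarithmic derivative of `e ^ a(X) * e ^ b(X)` is `z X`, then
`e ^ a(1) * e ^ b(1) = e ^ z`. -/
theorem truncExp_mul_truncExp [CharZero 𝕜] {a b : Q[X]} {z : Q} (ha : a ∈ coeffsIn (J 1))
    (hb : b ∈ coeffsIn (J 1)) (hz : z ∈ J 1) (ha0 : a.coeff 0 = 0) (hb0 : b.coeff 0 = 0)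
    (h : ∑ m ∈ Finset.range K, ((m.factorial : 𝕜)⁻¹) • (negAd 𝕜 b ^ m)
          (∑ m ∈ Finset.range K, (((m + 1).factorial : 𝕜)⁻¹) • (negAd 𝕜 a ^ m) (euler 𝕜 a)) +
        ∑ m ∈ Finset.range K, (((m + 1).factorial : 𝕜)⁻¹) • (negAd 𝕜 b ^ m) (euler 𝕜 b) =
      C z * X) :
    truncExp 𝕜 K (a.eval 1) * truncExp 𝕜 K (b.eval 1) = truncExp 𝕜 K z := by
  have hP := hJ.polynomial
  set g := truncExp 𝕜 K a * truncExp 𝕜 K b with hg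
  -- By the Leibniz rule, with the logarithmic derivative of the first exponential moved past the
  -- second, which applies `e ^ (-ad b)` to it.
  have hD : euler 𝕜 g = g * (C z * X) := by
    rw [hg, euler_mul, map_truncExp (euler 𝕜) euler_mul K a (hP.pow_eq_zero ha le_rfl)
      (hP.pow_mul_negAd_pow_eq_zero ha _), map_truncExp (euler 𝕜) euler_mul K b
      (hP.pow_eq_zero hb le_rfl) (hP.pow_mul_negAd_pow_eq_zero hb _), mul_assoc,
      mul_truncExp (𝕜 := 𝕜) K b _ (hP.pow_mul_negAd_pow_eq_zero hb _), ← h]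
    simp only [mul_add, mul_assoc]
  -- the constant coefficient is that of the truncated exponential of zero
  have hzero : ∀ p : Q[X], p.coeff 0 = 0 →
      (truncExp 𝕜 K p).coeff 0 = if K = 0 then 0 else 1 := by
    intro p hp
    rw [truncExp, finsetSum_coeff]
    cases K with
    | zero => simp
    | succ K =>
      rw [Finset.sum_range_succ']
      simp only [coeff_smul, pow_succ, mul_coeff_zero, hp, mul_zero,
        smul_zero, Finset.sum_const_zero, zero_add]
      simp
  have hcoeff : ∀ n, g.coeff n = ((n.factorial : 𝕜)⁻¹) • z ^ n := by
    intro n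
    induction n with
    | zero =>
      rw [hg, mul_coeff_zero, hzero a ha0, hzero b hb0]
      -- For `K = 0` the truncated exponentials are empty sums, but then `J 0` is both `⊤` and `⊥`
      -- and the ring is trivial.
      by_cases hK : K = 0
      · have : (1 : Q) = 0 := hJ.eq_zero (n := 0) hK.le (by rw [hJ.top]; trivial)
        simp [this]
      · simp [hK]
    | succ n ih =>
      -- The differential equation is the recursion `(n + 1) gₙ₊₁ = gₙ z` for the coefficients.
      have h1 := congr(($hD).coeff (n + 1))
      rw [coeff_euler, ← mul_assoc, coeff_mul_X, coeff_mul_C, ih] at h1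
      have hn : ((n + 1 : ℕ) : 𝕜) ≠ 0 := Nat.cast_ne_zero.2 n.succ_ne_zero
      have h2 := congr((((n + 1 : ℕ) : 𝕜)⁻¹) • $h1)
      rw [smul_smul, inv_mul_cancel₀ hn, one_smul] at h2
      rw [h2, smul_mul_assoc, ← pow_succ, smul_smul, Nat.factorial_succ, Nat.cast_mul, mul_inv]
  -- Evaluation is multiplicative over the noncommutative ring `Q` because the point 1 is central.
  let ev : Q[X] →+* Q := eval₂RingHom' (RingHom.id Q) 1 (fun x => Commute.one_right x)
  have hev : ∀ p : Q[X], ev p = p.eval 1 := fun p => rfl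
  have hsum : ∀ p : Q[X], p.eval 1 = p.sum fun _ c => c := by
    intro p
    simp [eval_eq_sum]
  have hevs : ∀ (c : 𝕜) (p : Q[X]), ev (c • p) = c • ev p := by
    intro c p
    rw [hev, hev, eval_smul]
  have hexp : ∀ p : Q[X], truncExp 𝕜 K (p.eval 1) = ev (truncExp 𝕜 K p) := by
    intro p
    rw [truncExp, truncExp, map_sum]
    refine Finset.sum_congr rfl fun k _ => ?_
    rw [hevs, map_pow, hev]
  rw [hexp, hexp, ← map_mul, ← hg, hev, eval_eq_sum_range' (n := max K (g.natDegree + 1))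
    (lt_of_lt_of_le (Nat.lt_succ_self _) (le_max_right _ _)), truncExp]
  simp only [one_pow, mul_one, hcoeff]
  symm
  refine Finset.sum_subset (Finset.range_subset_range.2 (le_max_left _ _)) fun n _ hn => ?_
  rw [hJ.pow_eq_zero hz (by simpa using hn), smul_zero]

end NilFiltration

end Filtered

/-! ### The universal factorization in terms of words -/

section Words

variable (𝕜 : Type*) [Field 𝕜]

/-- The bracket of finite linear combinations of words. -/
def wordBracket : (Word →₀ 𝕜) →ₗ[𝕜] (Word →₀ 𝕜) →ₗ[𝕜] (Word →₀ 𝕜) :=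
  Finsupp.linearCombination 𝕜 fun v => Finsupp.lmapDomain 𝕜 𝕜 (Word.bracket v)

/-- The formal projection `projMinus` of finite linear combinations of words. -/
def wordMinus : (Word →₀ 𝕜) →ₗ[𝕜] (Word →₀ 𝕜) := Finsupp.lmapDomain 𝕜 𝕜 Word.projMinus

/-- The formal projection `projPlus` of finite linear combinations of words. -/
def wordPlus : (Word →₀ 𝕜) →ₗ[𝕜] (Word →₀ 𝕜) := Finsupp.lmapDomain 𝕜 𝕜 Word.projPlus

variable {𝕜}

/-- The operator `-ad β` on sequences without constant term, seen as graded by the index. -/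
def wordNegAd (β γ : ℕ → Word →₀ 𝕜) (n : ℕ) : Word →₀ 𝕜 :=
  -∑ p ∈ Finset.HasAntidiagonal.antidiagonal n with p.1 ≠ 0 ∧ p.2 ≠ 0, wordBracket 𝕜 (β p.1) (γ p.2)

/-- The operator `∑ c m (-ad β) ^ m`, where the sum is over positive `m`. -/
def wordSeriesAd (c : ℕ → 𝕜) (β γ : ℕ → Word →₀ 𝕜) (n : ℕ) : Word →₀ 𝕜 :=
  ∑ m ∈ Finset.range n, c (m + 1) • (wordNegAd β)^[m + 1] γ n

/-- The coefficients of the exponential series. -/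
def expCoeff (𝕜 : Type*) [Field 𝕜] (m : ℕ) : 𝕜 := (m.factorial : 𝕜)⁻¹

/-- The coefficients of `(e ^ z - 1) / z`. -/
def psiCoeff (𝕜 : Type*) [Field 𝕜] (m : ℕ) : 𝕜 := ((m + 1).factorial : 𝕜)⁻¹

/-- The sequence of `n * α n`. -/
def weighted (α : ℕ → Word →₀ 𝕜) (n : ℕ) : Word →₀ 𝕜 := (n : 𝕜) • α n

/-- The sequence of `(n - 1) * α n`. -/
def weightedSub (α : ℕ → Word →₀ 𝕜) (n : ℕ) : Word →₀ 𝕜 := (n : 𝕜) • α n - α n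

/-- The difference of the logarithmic derivative of `e ^ α * e ^ β` and the derivative of
`α + β`. -/
def remainder (α β : ℕ → Word →₀ 𝕜) (n : ℕ) : Word →₀ 𝕜 :=
  wordSeriesAd (psiCoeff 𝕜) α (weightedSub α) n +
    wordSeriesAd (expCoeff 𝕜) β
      (weighted α + wordSeriesAd (psiCoeff 𝕜) α (weightedSub α)) n +
    wordSeriesAd (psiCoeff 𝕜) β (weightedSub β) n

/-- The homogeneous components of the two factors, by recursion on the degree. -/
def factors (𝕜 : Type*) [Field 𝕜] : ℕ → (Word →₀ 𝕜) × (Word →₀ 𝕜)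
  | n =>
    -- Cutting the sequences off at `n` makes the recursion well founded and changes nothing, by
    -- `remainder_congr`.
    let N := remainder (fun i => if _ : i < n then (factors 𝕜 i).1 else 0)
      (fun i => if _ : i < n then (factors 𝕜 i).2 else 0) n
    ((n : 𝕜)⁻¹ • ((if n = 1 then Finsupp.single Word.minus 1 else 0) - wordMinus 𝕜 N),
      (n : 𝕜)⁻¹ • ((if n = 1 then Finsupp.single Word.plus 1 else 0) - wordPlus 𝕜 N))

/-- The degree `n` part of the first factor. -/
def factorMinus (𝕜 : Type*) [Field 𝕜] (n : ℕ) : Word →₀ 𝕜 := (factors 𝕜 n).1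

/-- The degree `n` part of the second factor. -/
def factorPlus (𝕜 : Type*) [Field 𝕜] (n : ℕ) : Word →₀ 𝕜 := (factors 𝕜 n).2

section Locality

variable {α α' β β' γ γ' : ℕ → Word →₀ 𝕜} {n : ℕ}

/-- Both indices of a bracket are nonzero, so its degree `i` part uses only indices below `i`. This
gain of one is what makes the recursion determinate. -/
theorem wordNegAd_congr (hβ : ∀ i < n, β i = β' i) (hγ : ∀ i < n, γ i = γ' i) :
    ∀ i < n + 1, wordNegAd β γ i = wordNegAd β' γ' i := by
  intro i hi
  rw [wordNegAd, wordNegAd]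
  congr 1
  refine Finset.sum_congr rfl fun p hp => ?_
  simp only [Finset.mem_filter, Finset.HasAntidiagonal.mem_antidiagonal] at hp
  rw [hβ p.1 (by omega), hγ p.2 (by omega)]

theorem iterate_wordNegAd_congr (hβ : ∀ i < n, β i = β' i) (hγ : ∀ i < n, γ i = γ' i) (m : ℕ) :
    ∀ i < n + 1, (wordNegAd β)^[m + 1] γ i = (wordNegAd β')^[m + 1] γ' i := by
  induction m with
  | zero => exact wordNegAd_congr hβ hγ
  | succ m ih =>
    rw [Function.iterate_succ_apply' _ (m + 1), Function.iterate_succ_apply' _ (m + 1)]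
    exact wordNegAd_congr hβ fun i hi => ih i (by omega)

theorem wordSeriesAd_congr (c : ℕ → 𝕜) (hβ : ∀ i < n, β i = β' i) (hγ : ∀ i < n, γ i = γ' i) :
    ∀ i < n + 1, wordSeriesAd c β γ i = wordSeriesAd c β' γ' i := by
  intro i hi
  refine Finset.sum_congr rfl fun m _ => ?_
  rw [iterate_wordNegAd_congr hβ hγ m i hi]

theorem remainder_congr (hα : ∀ i < n, α i = α' i) (hβ : ∀ i < n, β i = β' i) :
    remainder α β n = remainder α' β' n := by
  have h1 := wordSeriesAd_congr (psiCoeff 𝕜) hα (γ := weightedSub α) (γ' := weightedSub α')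
    fun i hi => by rw [weightedSub, weightedSub, hα i hi]
  have h2 := wordSeriesAd_congr (psiCoeff 𝕜) hβ (γ := weightedSub β) (γ' := weightedSub β')
    fun i hi => by rw [weightedSub, weightedSub, hβ i hi]
  have h3 := wordSeriesAd_congr (expCoeff 𝕜) hβ
    (γ := weighted α + wordSeriesAd (psiCoeff 𝕜) α (weightedSub α))
    (γ' := weighted α' + wordSeriesAd (psiCoeff 𝕜) α' (weightedSub α'))
    fun i hi => by
      rw [Pi.add_apply, Pi.add_apply, weighted, weighted, hα i hi, h1 i (by omega)]
  rw [remainder, remainder, h1 n (by omega), h2 n (by omega), h3 n (by omega)]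

end Locality

theorem factors_eq (n : ℕ) : factors 𝕜 n =
    ((n : 𝕜)⁻¹ • ((if n = 1 then Finsupp.single Word.minus 1 else 0) -
        wordMinus 𝕜 (remainder (factorMinus 𝕜) (factorPlus 𝕜) n)),
      (n : 𝕜)⁻¹ • ((if n = 1 then Finsupp.single Word.plus 1 else 0) -
        wordPlus 𝕜 (remainder (factorMinus 𝕜) (factorPlus 𝕜) n))) := by
  have h : remainder (fun i => if _ : i < n then (factors 𝕜 i).1 else 0)
      (fun i => if _ : i < n then (factors 𝕜 i).2 else 0) n =
      remainder (factorMinus 𝕜) (factorPlus 𝕜) n :=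
    remainder_congr (fun i hi => dif_pos hi) (fun i hi => dif_pos hi)
  rw [factors, h]

theorem factorMinus_eq (n : ℕ) : factorMinus 𝕜 n =
    (n : 𝕜)⁻¹ • ((if n = 1 then Finsupp.single Word.minus 1 else 0) -
        wordMinus 𝕜 (remainder (factorMinus 𝕜) (factorPlus 𝕜) n)) := by
  rw [factorMinus, factors_eq]

theorem factorPlus_eq (n : ℕ) : factorPlus 𝕜 n =
    (n : 𝕜)⁻¹ • ((if n = 1 then Finsupp.single Word.plus 1 else 0) -
        wordPlus 𝕜 (remainder (factorMinus 𝕜) (factorPlus 𝕜) n)) := by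
  rw [factorPlus, factors_eq]

/-! #### Letters occurring in the factors -/

/-- Words with `n` letters, at least one of them `minus`. -/
def withMinus (n : ℕ) : Set Word := {w | w.countMinus + w.countPlus = n ∧ 1 ≤ w.countMinus}

/-- Words with `n` letters, at least one of them `plus`. -/
def withPlus (n : ℕ) : Set Word := {w | w.countMinus + w.countPlus = n ∧ 1 ≤ w.countPlus}

/-- Words with `n` letters of both kinds. -/
def mixed (n : ℕ) : Set Word :=
  {w | w.countMinus + w.countPlus = n ∧ 1 ≤ w.countMinus ∧ 1 ≤ w.countPlus}

theorem wordBracket_single (v w : Word) (c d : 𝕜) :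
    wordBracket 𝕜 (Finsupp.single v c) (Finsupp.single w d) =
      Finsupp.single (Word.bracket v w) (c * d) := by
  simp [wordBracket]

theorem wordBracket_mem {S T U : Set Word} (h : ∀ v ∈ S, ∀ w ∈ T, Word.bracket v w ∈ U)
    {x y : Word →₀ 𝕜} (hx : x ∈ Finsupp.supported 𝕜 𝕜 S) (hy : y ∈ Finsupp.supported 𝕜 𝕜 T) :
    wordBracket 𝕜 x y ∈ Finsupp.supported 𝕜 𝕜 U := by
  rw [wordBracket, Finsupp.linearCombination_apply, Finsupp.sum, LinearMap.sum_apply]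
  refine sum_mem fun v hv => ?_
  rw [LinearMap.smul_apply]
  refine Submodule.smul_mem _ _ ?_
  have : Finsupp.lmapDomain 𝕜 𝕜 (Word.bracket v) y ∈
      (Finsupp.supported 𝕜 𝕜 T).map (Finsupp.lmapDomain 𝕜 𝕜 (Word.bracket v)) :=
    Submodule.mem_map_of_mem hy
  rw [Finsupp.lmapDomain_supported] at this
  refine Finsupp.supported_mono ?_ this
  rintro _ ⟨w, hw, rfl⟩
  exact h v (hx hv) w hw

theorem lmapDomain_mem {S U : Set Word} {f : Word → Word} (h : ∀ v ∈ S, f v ∈ U) {x : Word →₀ 𝕜}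
    (hx : x ∈ Finsupp.supported 𝕜 𝕜 S) :
    Finsupp.lmapDomain 𝕜 𝕜 f x ∈ Finsupp.supported 𝕜 𝕜 U := by
  have : Finsupp.lmapDomain 𝕜 𝕜 f x ∈
      (Finsupp.supported 𝕜 𝕜 S).map (Finsupp.lmapDomain 𝕜 𝕜 f) := Submodule.mem_map_of_mem hx
  rw [Finsupp.lmapDomain_supported] at this
  refine Finsupp.supported_mono ?_ this
  rintro _ ⟨w, hw, rfl⟩
  exact h w hw

section Support

variable {α β γ : ℕ → Word →₀ 𝕜} {n : ℕ} {S T : ℕ → Set Word}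

theorem wordNegAd_mem (hST : ∀ i j, ∀ v ∈ S i, ∀ w ∈ T j, Word.bracket v w ∈ mixed (i + j))
    (hβ : ∀ i < n, β i ∈ Finsupp.supported 𝕜 𝕜 (S i))
    (hγ : ∀ i < n, γ i ∈ Finsupp.supported 𝕜 𝕜 (T i)) :
    ∀ i < n + 1, wordNegAd β γ i ∈ Finsupp.supported 𝕜 𝕜 (mixed i) := by
  intro i hi
  refine neg_mem (sum_mem fun p hp => ?_)
  simp only [Finset.mem_filter, Finset.HasAntidiagonal.mem_antidiagonal] at hp
  have := wordBracket_mem (hST p.1 p.2) (hβ p.1 (by omega)) (hγ p.2 (by omega))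
  rwa [hp.1] at this

theorem wordSeriesAd_mem (c : ℕ → 𝕜)
    (hST : ∀ i j, ∀ v ∈ S i, ∀ w ∈ T j, Word.bracket v w ∈ mixed (i + j))
    (hT : ∀ i, mixed i ⊆ T i)
    (hβ : ∀ i < n, β i ∈ Finsupp.supported 𝕜 𝕜 (S i))
    (hγ : ∀ i < n, γ i ∈ Finsupp.supported 𝕜 𝕜 (T i)) :
    ∀ i < n + 1, wordSeriesAd c β γ i ∈ Finsupp.supported 𝕜 𝕜 (mixed i) := by
  have key : ∀ m, ∀ i < n + 1,
      (wordNegAd β)^[m + 1] γ i ∈ Finsupp.supported 𝕜 𝕜 (mixed i) := by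
    intro m
    induction m with
    | zero => exact wordNegAd_mem hST hβ hγ
    | succ m ih =>
      rw [Function.iterate_succ_apply']
      exact wordNegAd_mem hST hβ fun i hi => Finsupp.supported_mono (hT i) (ih i (by omega))
  intro i hi
  exact sum_mem fun m _ => Submodule.smul_mem _ _ (key m i hi)

/-- The factor `n - 1` removes the single letter in degree one. Formal brackets are not alternating,
so with `weighted` instead, the remainder would contain the bracket of a letter with itself;
subtracting `α` is harmless under evaluation since `ad α` kills `α`. -/
theorem weightedSub_mem
    (h : ∀ i < n, 2 ≤ i → α i ∈ Finsupp.supported 𝕜 𝕜 (mixed i)) (h0 : α 0 = 0) :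
    ∀ i < n, weightedSub α i ∈ Finsupp.supported 𝕜 𝕜 (mixed i) := by
  intro i hi
  rw [weightedSub]
  rcases i with _ | _ | i
  · simp [h0]
  · simp
  · have := h _ hi (by omega)
    exact sub_mem (Submodule.smul_mem _ _ this) this

/-- Each of the three terms brackets words containing one letter with words containing the other:
`withMinus` with `mixed`, `withPlus` with `withMinus`, and `withPlus` with `mixed`. -/
theorem remainder_mem (hα : ∀ i < n, α i ∈ Finsupp.supported 𝕜 𝕜 (withMinus i))
    (hα2 : ∀ i < n, 2 ≤ i → α i ∈ Finsupp.supported 𝕜 𝕜 (mixed i))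
    (hβ : ∀ i < n, β i ∈ Finsupp.supported 𝕜 𝕜 (withPlus i))
    (hβ2 : ∀ i < n, 2 ≤ i → β i ∈ Finsupp.supported 𝕜 𝕜 (mixed i))
    (hα0 : α 0 = 0) (hβ0 : β 0 = 0) :
    remainder α β n ∈ Finsupp.supported 𝕜 𝕜 (mixed n) := by
  have h1 := wordSeriesAd_mem (psiCoeff 𝕜) (S := withMinus) (T := mixed) (fun i j v hv w hw => by
    simp only [withMinus, mixed, Word.countMinus, Word.countPlus, Set.mem_ofPred_eq] at *
    omega) (fun i => subset_rfl) hα (weightedSub_mem hα2 hα0)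
  have h2 := wordSeriesAd_mem (psiCoeff 𝕜) (S := withPlus) (T := mixed) (fun i j v hv w hw => by
    simp only [withPlus, mixed, Word.countMinus, Word.countPlus, Set.mem_ofPred_eq] at *
    omega) (fun i => subset_rfl) hβ (weightedSub_mem hβ2 hβ0)
  have hsub : ∀ i, mixed i ⊆ withMinus i := fun i w hw => ⟨hw.1, hw.2.1⟩
  have h3 := wordSeriesAd_mem (expCoeff 𝕜) (S := withPlus) (T := withMinus)
    (γ := weighted α + wordSeriesAd (psiCoeff 𝕜) α (weightedSub α)) (fun i j v hv w hw => by
    simp only [withPlus, withMinus, mixed, Word.countMinus, Word.countPlus,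
      Set.mem_ofPred_eq] at *
    omega) hsub hβ (fun i hi => add_mem (Submodule.smul_mem _ _ (hα i hi))
      (Finsupp.supported_mono (hsub i) (h1 i (by omega))))
  exact add_mem (add_mem (h1 n (by omega)) (h3 n (by omega))) (h2 n (by omega))

end Support

/-- The convention `0⁻¹ = 0` annihilates the constant term. -/
theorem factorMinus_zero : factorMinus 𝕜 0 = 0 := by rw [factorMinus_eq]; simp

theorem factorPlus_zero : factorPlus 𝕜 0 = 0 := by rw [factorPlus_eq]; simp

/-- The claims are proved together, since the remainder in degree `n` depends on both factors below
`n` and determines both in degree `n`. Only degree one contains a word that is not mixed. -/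
theorem factors_mem (n : ℕ) :
    remainder (factorMinus 𝕜) (factorPlus 𝕜) n ∈ Finsupp.supported 𝕜 𝕜 (mixed n) ∧
    factorMinus 𝕜 n ∈ Finsupp.supported 𝕜 𝕜 (withMinus n) ∧
    (2 ≤ n → factorMinus 𝕜 n ∈ Finsupp.supported 𝕜 𝕜 (mixed n)) ∧
    factorPlus 𝕜 n ∈ Finsupp.supported 𝕜 𝕜 (withPlus n) ∧
    (2 ≤ n → factorPlus 𝕜 n ∈ Finsupp.supported 𝕜 𝕜 (mixed n)) := by
  induction n using Nat.strong_induction_on with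
  | _ n ih =>
  have hr : remainder (factorMinus 𝕜) (factorPlus 𝕜) n ∈ Finsupp.supported 𝕜 𝕜 (mixed n) :=
    remainder_mem (fun i hi => (ih i hi).2.1) (fun i hi => (ih i hi).2.2.1)
      (fun i hi => (ih i hi).2.2.2.1) (fun i hi => (ih i hi).2.2.2.2)
      factorMinus_zero factorPlus_zero
  have hm : wordMinus 𝕜 (remainder (factorMinus 𝕜) (factorPlus 𝕜) n) ∈
      Finsupp.supported 𝕜 𝕜 (mixed n) := lmapDomain_mem (f := Word.projMinus) (fun _ hv => hv) hr
  have hp : wordPlus 𝕜 (remainder (factorMinus 𝕜) (factorPlus 𝕜) n) ∈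
      Finsupp.supported 𝕜 𝕜 (mixed n) := lmapDomain_mem (f := Word.projPlus) (fun _ hv => hv) hr
  refine ⟨hr, ?_, fun hn => ?_, ?_, fun hn => ?_⟩
  · rw [factorMinus_eq]
    refine Submodule.smul_mem _ _ (sub_mem ?_ (Finsupp.supported_mono
      (fun w (hw : w ∈ mixed n) => (⟨hw.1, hw.2.1⟩ : w ∈ withMinus n)) hm))
    split_ifs with h
    · subst h
      exact Finsupp.single_mem_supported 𝕜 1 ⟨rfl, le_rfl⟩
    · exact zero_mem _
  · rw [factorMinus_eq, if_neg (by omega)]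
    exact Submodule.smul_mem _ _ (sub_mem (zero_mem _) hm)
  · rw [factorPlus_eq]
    refine Submodule.smul_mem _ _ (sub_mem ?_ (Finsupp.supported_mono
      (fun w (hw : w ∈ mixed n) => (⟨hw.1, hw.2.2⟩ : w ∈ withPlus n)) hp))
    split_ifs with h
    · subst h
      exact Finsupp.single_mem_supported 𝕜 1 ⟨rfl, le_rfl⟩
    · exact zero_mem _
  · rw [factorPlus_eq, if_neg (by omega)]
    exact Submodule.smul_mem _ _ (sub_mem (zero_mem _) hp)

/-! #### The terms with at most two letters -/

theorem remainder_one : remainder (factorMinus 𝕜) (factorPlus 𝕜) 1 = 0 := by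
  have h := (factors_mem (𝕜 := 𝕜) 1).1
  have : mixed 1 = ∅ := by
    ext w
    simp only [mixed, Set.mem_ofPred_eq, Set.mem_empty_iff_false, iff_false]
    omega
  simpa [this] using h

theorem factorMinus_one : factorMinus 𝕜 1 = Finsupp.single Word.minus 1 := by
  rw [factorMinus_eq, remainder_one]; simp

theorem factorPlus_one : factorPlus 𝕜 1 = Finsupp.single Word.plus 1 := by
  rw [factorPlus_eq, remainder_one]; simp

theorem wordNegAd_eq_zero (β γ : ℕ → Word →₀ 𝕜) {n : ℕ} (hn : n < 2) : wordNegAd β γ n = 0 := by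
  rw [wordNegAd, Finset.filter_false_of_mem, Finset.sum_empty, neg_zero]
  intro p hp
  rw [Finset.HasAntidiagonal.mem_antidiagonal] at hp
  omega

theorem wordNegAd_two (β γ : ℕ → Word →₀ 𝕜) :
    wordNegAd β γ 2 = -wordBracket 𝕜 (β 1) (γ 1) := by
  have : {p ∈ Finset.HasAntidiagonal.antidiagonal 2 | p.1 ≠ 0 ∧ p.2 ≠ 0} = {((1, 1) : ℕ × ℕ)} := by decide
  rw [wordNegAd, this, Finset.sum_singleton]

theorem wordSeriesAd_one (c : ℕ → 𝕜) (β γ : ℕ → Word →₀ 𝕜) : wordSeriesAd c β γ 1 = 0 := by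
  simp [wordSeriesAd, wordNegAd_eq_zero]

theorem wordSeriesAd_two (c : ℕ → 𝕜) (β γ : ℕ → Word →₀ 𝕜) :
    wordSeriesAd c β γ 2 = -(c 1 • wordBracket 𝕜 (β 1) (γ 1)) := by
  simp [wordSeriesAd, Finset.sum_range_succ, wordNegAd_two, wordNegAd_eq_zero]

/-- Only `e ^ (-ad β)` contributes, because `weightedSub` vanishes in degree one. Division by the
degree 2 then gives the coefficient 1/2 of the factors. -/
theorem remainder_two : remainder (factorMinus 𝕜) (factorPlus 𝕜) 2 =
    -Finsupp.single (Word.bracket Word.plus Word.minus) 1 := by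
  simp [remainder, wordSeriesAd_two, wordSeriesAd_one, weightedSub, weighted, expCoeff,
    factorMinus_one, factorPlus_one, wordBracket_single]

theorem factorMinus_two : factorMinus 𝕜 2 =
    Finsupp.single (Word.projMinus (Word.bracket Word.plus Word.minus)) (1 / 2) := by
  rw [factorMinus_eq, remainder_two, map_neg, wordMinus, Finsupp.lmapDomain_apply, Finsupp.mapDomain_single]
  simp

theorem factorPlus_two : factorPlus 𝕜 2 =
    Finsupp.single (Word.projPlus (Word.bracket Word.plus Word.minus)) (1 / 2) := by
  rw [factorPlus_eq, remainder_two, map_neg, wordPlus, Finsupp.lmapDomain_apply, Finsupp.mapDomain_single]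
  simp

end Words

/-! ### Evaluation of the universal factorization in a nilpotent algebra -/

section Transport

open Polynomial

variable {𝕜 Q : Type*} [Field 𝕜] [Ring Q] [Algebra 𝕜 Q]

/-- The polynomial `p` has the values of `γ` as coefficients and no constant term. -/
def Represents (ε : (Word →₀ 𝕜) →ₗ[𝕜] Q) (p : Q[X]) (γ : ℕ → Word →₀ 𝕜) : Prop :=
  p.coeff 0 = 0 ∧ ∀ n, p.coeff n = ε (γ n)

namespace Represents

variable {ε : (Word →₀ 𝕜) →ₗ[𝕜] Q} {p q : Q[X]} {β γ : ℕ → Word →₀ 𝕜}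

theorem add (hp : Represents ε p β) (hq : Represents ε q γ) : Represents ε (p + q) (β + γ) :=
  ⟨by rw [coeff_add, hp.1, hq.1, add_zero],
    fun n => by rw [coeff_add, hp.2, hq.2, Pi.add_apply, map_add]⟩

/-- The pairs with a zero index that `wordNegAd` omits contribute nothing, as the constant
coefficients of `p` and `q` vanish. -/
theorem negAd (hε : ∀ x y, ε (wordBracket 𝕜 x y) = ε x * ε y - ε y * ε x)
    (hp : Represents ε p β) (hq : Represents ε q γ) :
    Represents ε (negAd 𝕜 p q) (wordNegAd β γ) := by
  have h : ∀ n, (FormalFactorization.negAd 𝕜 p q).coeff n = ε (wordNegAd β γ n) := by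
    intro n
    rw [negAd_apply, coeff_sub, coeff_mul, coeff_mul, wordNegAd, map_neg, map_sum,
      ← Finset.Nat.sum_antidiagonal_swap, ← Finset.sum_sub_distrib, Finset.sum_filter,
      ← Finset.sum_neg_distrib]
    refine Finset.sum_congr rfl fun x _ => ?_
    rw [Prod.fst_swap, Prod.snd_swap]
    split_ifs with hx
    · rw [hε, hp.2, hq.2, neg_sub]
    · rw [not_and_or, not_not, not_not] at hx
      rcases hx with hx | hx <;> simp [hx, hp.1, hq.1]
  refine ⟨?_, h⟩
  rw [h, wordNegAd_eq_zero _ _ (by omega), map_zero]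

theorem negAd_pow (hε : ∀ x y, ε (wordBracket 𝕜 x y) = ε x * ε y - ε y * ε x)
    (hp : Represents ε p β) (hq : Represents ε q γ) (m : ℕ) :
    Represents ε ((FormalFactorization.negAd 𝕜 p ^ m) q) ((wordNegAd β)^[m] γ) := by
  induction m with
  | zero => exact hq
  | succ m ih =>
    rw [pow_succ', Module.End.mul_apply, Function.iterate_succ_apply']
    exact negAd hε hp ih

end Represents

/-- The first bracket starts in degree two, and each further one raises the lowest degree by at
least one. Hence the cutoff at `n` in `wordSeriesAd` loses nothing. -/
theorem iterate_wordNegAd_eq_zero (β γ : ℕ → Word →₀ 𝕜) (m : ℕ) :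
    ∀ n < m + 2, (wordNegAd β)^[m + 1] γ n = 0 := by
  induction m with
  | zero => exact fun n hn => wordNegAd_eq_zero β γ hn
  | succ m ih =>
    intro n hn
    rw [Function.iterate_succ_apply', wordNegAd, Finset.sum_eq_zero, neg_zero]
    intro x hx
    simp only [Finset.mem_filter, Finset.HasAntidiagonal.mem_antidiagonal] at hx
    rw [ih x.2 (by omega), map_zero]

theorem Represents.seriesAd {ε : (Word →₀ 𝕜) →ₗ[𝕜] Q} {p q : Q[X]} {β γ : ℕ → Word →₀ 𝕜}
    (hε : ∀ x y, ε (wordBracket 𝕜 x y) = ε x * ε y - ε y * ε x) (c : ℕ → 𝕜) {K : ℕ}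
    (hK : ∀ m, K ≤ m → (FormalFactorization.negAd 𝕜 p ^ m) q = 0)
    (hp : Represents ε p β) (hq : Represents ε q γ) :
    Represents ε (∑ m ∈ Finset.range K, c (m + 1) • (FormalFactorization.negAd 𝕜 p ^ (m + 1)) q)
      (wordSeriesAd c β γ) := by
  have h : ∀ n, (∑ m ∈ Finset.range K,
      c (m + 1) • (FormalFactorization.negAd 𝕜 p ^ (m + 1)) q).coeff n =
      ε (wordSeriesAd c β γ n) := by
    intro n
    rw [finsetSum_coeff, wordSeriesAd, map_sum]
    have e : ∀ m, (c (m + 1) • (FormalFactorization.negAd 𝕜 p ^ (m + 1)) q).coeff n =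
        ε (c (m + 1) • (wordNegAd β)^[m + 1] γ n) := fun m => by
      rw [coeff_smul, (negAd_pow hε hp hq (m + 1)).2, map_smul]
    rw [← Finset.sum_congr rfl fun m _ => e m]
    -- One sum is cut off at `K` by nilpotency, the other at `n` by degree; both extend by zeros to
    -- `max K n`.
    rw [Finset.sum_subset (Finset.range_subset_range.2 (le_max_left K n)) fun m _ hm => by
        rw [hK (m + 1) (by have := Finset.mem_range.not.1 hm; omega), smul_zero, coeff_zero],
      Finset.sum_subset (Finset.range_subset_range.2 (le_max_right K n)) fun m _ hm => by
        rw [e, iterate_wordNegAd_eq_zero β γ m n (by have := Finset.mem_range.not.1 hm; omega),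
          smul_zero, map_zero]]
  exact ⟨by rw [h]; simp [wordSeriesAd], h⟩

theorem sum_negAd_pow_eq (c : ℕ → 𝕜) {K : ℕ} {p q : Q[X]} (hc : c 0 = 1)
    (hK : ∀ m, K ≤ m → (negAd 𝕜 p ^ m) q = 0) :
    ∑ m ∈ Finset.range K, c m • (negAd 𝕜 p ^ m) q =
      q + ∑ m ∈ Finset.range K, c (m + 1) • (negAd 𝕜 p ^ (m + 1)) q := by
  have h : ∑ m ∈ Finset.range K, c m • (negAd 𝕜 p ^ m) q =
      ∑ m ∈ Finset.range (K + 1), c m • (negAd 𝕜 p ^ m) q := by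
    rw [Finset.sum_range_succ, hK K le_rfl, smul_zero, add_zero]
  rw [h, Finset.sum_range_succ', pow_zero, hc, one_smul, add_comm, Module.End.one_apply]

/-- The factorization `e ^ a * e ^ b = e ^ (x + y)` in a nilpotent algebra, where `a` and `b` are the
values of the universal factors. -/
theorem truncExp_factors [CharZero 𝕜] {J : ℕ → Submodule 𝕜 Q} {K : ℕ} (hJ : NilFiltration J K)
    (e : Word → Q) (hbr : ∀ v w, e (Word.bracket v w) = e v * e w - e w * e v)
    (hproj : ∀ w, e (Word.projMinus w) + e (Word.projPlus w) = e w)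
    (hmem : ∀ w, e w ∈ J (w.countMinus + w.countPlus)) :
    truncExp 𝕜 K (∑ n ∈ Finset.range K, Finsupp.linearCombination 𝕜 e (factorMinus 𝕜 n)) *
      truncExp 𝕜 K (∑ n ∈ Finset.range K, Finsupp.linearCombination 𝕜 e (factorPlus 𝕜 n)) =
      truncExp 𝕜 K (e Word.minus + e Word.plus) := by
  set ε := Finsupp.linearCombination 𝕜 e with hε
  have hbr' : ∀ x y, ε (wordBracket 𝕜 x y) = ε x * ε y - ε y * ε x := by
    intro x y
    induction x using Finsupp.induction_linear with
    | zero => simp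
    | add x x' hx hx' => simp only [map_add, LinearMap.add_apply, hx, hx', add_mul, mul_add]; abel
    | single v c =>
      induction y using Finsupp.induction_linear with
      | zero => simp
      | add y y' hy hy' => simp only [map_add, hy, hy', add_mul, mul_add]; abel
      | single w d =>
        simp only [wordBracket_single, hε, Finsupp.linearCombination_single, hbr, smul_sub,
          smul_mul_smul_comm, mul_comm d c]
  have hproj' : ∀ x, ε (wordMinus 𝕜 x) + ε (wordPlus 𝕜 x) = ε x := by
    intro x
    induction x using Finsupp.induction_linear with
    | zero => simp
    | add x x' hx hx' => rw [map_add, map_add, map_add, map_add, map_add, ← hx, ← hx']; abel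
    | single v c =>
      simp only [wordMinus, wordPlus, Finsupp.lmapDomain_apply, Finsupp.mapDomain_single, hε,
        Finsupp.linearCombination_single, ← smul_add, hproj]
  have hmem' : ∀ n x, x ∈ Finsupp.supported 𝕜 𝕜
      {w : Word | w.countMinus + w.countPlus = n} → ε x ∈ J n := by
    intro n x hx
    rw [hε, Finsupp.linearCombination_apply]
    refine sum_mem fun w hw => Submodule.smul_mem _ _ ?_
    have h : w.countMinus + w.countPlus = n := hx hw
    exact h ▸ hmem w
  have hA : ∀ n, ε (factorMinus 𝕜 n) ∈ J n := fun n =>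
    hmem' n _ (Finsupp.supported_mono (fun w hw => hw.1) (factors_mem n).2.1)
  have hB : ∀ n, ε (factorPlus 𝕜 n) ∈ J n := fun n =>
    hmem' n _ (Finsupp.supported_mono (fun w hw => hw.1) (factors_mem n).2.2.2.1)
  -- sequences as polynomials
  have hrep : ∀ α : ℕ → Word →₀ 𝕜, α 0 = 0 → (∀ n, ε (α n) ∈ J n) →
      ∃ p : Q[X], Represents ε p α ∧ p ∈ coeffsIn (J 1) ∧
        p.eval 1 = ∑ n ∈ Finset.range K, ε (α n) := by
    intro α h0 h
    have hp : ∀ n, (∑ n ∈ Finset.range K, monomial n (ε (α n))).coeff n = ε (α n) := by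
      intro n
      simp only [finsetSum_coeff, coeff_monomial, Finset.sum_ite_eq', Finset.mem_range]
      split_ifs with hn
      · rfl
      · exact (hJ.eq_zero (not_lt.1 hn) (h n)).symm
    refine ⟨_, ⟨by rw [hp, h0, map_zero], hp⟩, fun n => ?_, ?_⟩
    · rw [hp]
      rcases n with _ | n
      · rw [h0, map_zero]; exact zero_mem _
      · exact hJ.anti (by omega) (h _)
    · simp [eval_finsetSum]
  obtain ⟨a, ha, ha1, hae⟩ := hrep (factorMinus 𝕜) factorMinus_zero hA
  obtain ⟨b, hb, hb1, hbe⟩ := hrep (factorPlus 𝕜) factorPlus_zero hB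
  rw [← hae, ← hbe]
  have hP := hJ.polynomial
  refine hJ.truncExp_mul_truncExp ha1 hb1
    (add_mem (hmem Word.minus) (hmem Word.plus)) ha.1 hb.1 ?_
  have hvan : ∀ p ∈ coeffsIn (J 1), ∀ q : Q[X], ∀ m, K ≤ m → (negAd 𝕜 p ^ m) q = 0 :=
    fun p hp q m hm => hP.eq_zero hm (hP.negAd_pow_mem hp q m)
  have hw : ∀ p α, Represents ε p α → Represents ε (euler 𝕜 p) (weighted α) := fun p α h =>
    ⟨by simp [coeff_euler], fun n => by rw [coeff_euler, h.2, weighted, map_smul]⟩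
  have hws : ∀ p α, Represents ε p α → Represents ε (euler 𝕜 p - p) (weightedSub α) := fun p α h =>
    ⟨by simp [coeff_euler, h.1], fun n => by
      rw [coeff_sub, coeff_euler, h.2, weightedSub, map_sub, map_smul]⟩
  -- `(1 - e ^ (-ad p)) / ad p` fixes `p`
  have hpsi : ∀ p ∈ coeffsIn (J 1),
      ∑ m ∈ Finset.range K, (((m + 1).factorial : 𝕜)⁻¹) • (negAd 𝕜 p ^ m) (euler 𝕜 p) =
      euler 𝕜 p + ∑ m ∈ Finset.range K, psiCoeff 𝕜 (m + 1) •
        (negAd 𝕜 p ^ (m + 1)) (euler 𝕜 p - p) := by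
    intro p hp
    rw [show ∑ m ∈ Finset.range K, (((m + 1).factorial : 𝕜)⁻¹) • (negAd 𝕜 p ^ m) (euler 𝕜 p) =
      ∑ m ∈ Finset.range K, psiCoeff 𝕜 m • (negAd 𝕜 p ^ m) (euler 𝕜 p) from rfl,
      sum_negAd_pow_eq (psiCoeff 𝕜) (by simp [psiCoeff]) (hvan p hp _)]
    congr 1
    refine Finset.sum_congr rfl fun m _ => ?_
    have : (negAd 𝕜 p ^ (m + 1)) p = 0 := by
      rw [pow_succ, Module.End.mul_apply, negAd_apply, sub_self, map_zero]
    rw [map_sub, this, sub_zero]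
  rw [hpsi a ha1, hpsi b hb1]
  have h1 := Represents.seriesAd hbr' (psiCoeff 𝕜) (hvan a ha1 _) ha (hws a _ ha)
  have h2 := Represents.seriesAd hbr' (psiCoeff 𝕜) (hvan b hb1 _) hb (hws b _ hb)
  have h3 := (hw a _ ha).add h1
  have h4 := Represents.seriesAd hbr' (expCoeff 𝕜) (hvan b hb1 _) hb h3
  rw [show ∀ x : Q[X], ∑ m ∈ Finset.range K, ((m.factorial : 𝕜)⁻¹) • (negAd 𝕜 b ^ m) x =
    ∑ m ∈ Finset.range K, expCoeff 𝕜 m • (negAd 𝕜 b ^ m) x from fun _ => rfl,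
    sum_negAd_pow_eq (expCoeff 𝕜) (by simp [expCoeff]) (hvan b hb1 _)]
  have h5 := (h3.add h4).add ((hw b _ hb).add h2)
  ext n
  rw [h5.2]
  -- The recursion defining the factors, multiplied by `n` and added up; for `n = 0` both sides
  -- vanish.
  have hn : (n : 𝕜) • factorMinus 𝕜 n + (n : 𝕜) • factorPlus 𝕜 n =
      ((if n = 1 then Finsupp.single Word.minus 1 else 0) +
        (if n = 1 then Finsupp.single Word.plus 1 else 0)) -
      (wordMinus 𝕜 (remainder (factorMinus 𝕜) (factorPlus 𝕜) n) +
        wordPlus 𝕜 (remainder (factorMinus 𝕜) (factorPlus 𝕜) n)) := by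
    rcases n with _ | n
    · simp [remainder, wordSeriesAd]
    · have h0 : ((n + 1 : ℕ) : 𝕜) ≠ 0 := Nat.cast_ne_zero.2 n.succ_ne_zero
      conv_lhs => rw [factorMinus_eq, factorPlus_eq]
      rw [smul_inv_smul₀ h0, smul_inv_smul₀ h0]
      abel
  have ht : (weighted (factorMinus 𝕜) + wordSeriesAd (psiCoeff 𝕜) (factorMinus 𝕜)
        (weightedSub (factorMinus 𝕜)) +
      wordSeriesAd (expCoeff 𝕜) (factorPlus 𝕜) (weighted (factorMinus 𝕜) +
        wordSeriesAd (psiCoeff 𝕜) (factorMinus 𝕜) (weightedSub (factorMinus 𝕜))) +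
      (weighted (factorPlus 𝕜) + wordSeriesAd (psiCoeff 𝕜) (factorPlus 𝕜)
        (weightedSub (factorPlus 𝕜)))) n =
      ((n : 𝕜) • factorMinus 𝕜 n + (n : 𝕜) • factorPlus 𝕜 n) +
        remainder (factorMinus 𝕜) (factorPlus 𝕜) n := by
    simp only [Pi.add_apply, remainder, weighted]
    abel
  -- After evaluation the two projections of the remainder add up to the remainder and cancel it,
  -- leaving the letters in degree one.
  rw [ht, hn, map_add, map_sub, map_add, map_add, hproj', sub_add_cancel, coeff_C_mul, coeff_X]
  by_cases h : n = 1
  · simp [h, hε]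
  · simp [h, Ne.symm h]

end Transport

/-! ### Series modulo terms of high degree -/

/-- The linear map taking the coefficient of a series. -/
def coeffAt (𝕜 : Type*) {M : Type*} [Field 𝕜] [AddCommGroup M] [Module 𝕜 M] (d : Fin 2 →₀ ℕ) :
    Series M →ₗ[𝕜] M where
  toFun f := f d
  map_add' _ _ := rfl
  map_smul' _ _ := rfl

section Quotient

variable {𝕜 A : Type*} [Field 𝕜] [Ring A] [Algebra 𝕜 A]

/-- The ideal of series without terms of degree less than `k`. -/
def highDegree (A : Type*) [Ring A] (k : ℕ) : Ideal (Series A) where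
  carrier := {f | ∀ d : Fin 2 →₀ ℕ, d.degree < k → f d = 0}
  add_mem' {f g} hf hg d hd := by
    change f d + g d = 0
    rw [hf d hd, hg d hd, add_zero]
  zero_mem' _ _ := rfl
  smul_mem' c f hf d hd := by
    change MvPowerSeries.coeff d (c * f) = 0
    rw [MvPowerSeries.coeff_mul]
    refine Finset.sum_eq_zero fun p hp => ?_
    rw [Finset.HasAntidiagonal.mem_antidiagonal] at hp
    have h : p.1.degree + p.2.degree = d.degree := by rw [← hp, map_add]
    change _ * f p.2 = 0
    rw [hf p.2 (by omega), mul_zero]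

theorem mul_mem_highDegree {f g : Series A} {i j : ℕ} (hf : f ∈ highDegree A i)
    (hg : g ∈ highDegree A j) : f * g ∈ highDegree A (i + j) := by
  intro d hd
  change MvPowerSeries.coeff d (f * g) = 0
  rw [MvPowerSeries.coeff_mul]
  refine Finset.sum_eq_zero fun p hp => ?_
  rw [Finset.HasAntidiagonal.mem_antidiagonal] at hp
  have h : p.1.degree + p.2.degree = d.degree := by rw [← hp, map_add]
  change f p.1 * g p.2 = 0
  by_cases hi : p.1.degree < i
  · rw [hf p.1 hi, zero_mul]
  · rw [hg p.2 (by omega), mul_zero]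

theorem mem_highDegree_zero (f : Series A) : f ∈ highDegree A 0 := fun d hd => by omega

instance (k : ℕ) : (highDegree A k).IsTwoSided where
  mul_mem_of_left g hf := mul_mem_highDegree hf (mem_highDegree_zero g)

/-- Series modulo terms of degree at least `K`. -/
abbrev Truncated (A : Type*) [Ring A] (K : ℕ) := Series A ⧸ highDegree A K

/-- The quotient map to series modulo terms of degree at least `K`. -/
def truncate (𝕜 : Type*) (A : Type*) [Field 𝕜] [Ring A] [Algebra 𝕜 A] (K : ℕ) :
    Series A →ₐ[𝕜] Truncated A K := Ideal.Quotient.mkₐ 𝕜 (highDegree A K)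

theorem truncate_eq_zero {f : Series A} {K : ℕ} :
    truncate 𝕜 A K f = 0 ↔ f ∈ highDegree A K := Ideal.Quotient.eq_zero_iff_mem

theorem truncate_eq {f g : Series A} {K : ℕ} :
    truncate 𝕜 A K f = truncate 𝕜 A K g ↔ ∀ d : Fin 2 →₀ ℕ, d.degree < K → f d = g d := by
  rw [← sub_eq_zero, ← map_sub, truncate_eq_zero]
  exact forall₂_congr fun d _ => sub_eq_zero (a := f d) (b := g d)

/-- The filtration by degree of the series modulo terms of degree at least `K`. -/
def degreeFiltration (𝕜 : Type*) (A : Type*) [Field 𝕜] [Ring A] [Algebra 𝕜 A] (K k : ℕ) :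
    Submodule 𝕜 (Truncated A K) :=
  ((highDegree A k).restrictScalars 𝕜).map (truncate 𝕜 A K).toLinearMap

theorem truncate_mem {f : Series A} {K k : ℕ} (hf : f ∈ highDegree A k) :
    truncate 𝕜 A K f ∈ degreeFiltration 𝕜 A K k :=
  ⟨f, hf, rfl⟩

theorem nilFiltration (K : ℕ) : NilFiltration (degreeFiltration 𝕜 A K) K where
  top := by
    refine eq_top_iff.2 fun x _ => ?_
    obtain ⟨f, rfl⟩ := Ideal.Quotient.mk_surjective x
    exact ⟨f, mem_highDegree_zero f, rfl⟩
  anti i j hij := by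
    rintro _ ⟨f, hf, rfl⟩
    exact ⟨f, fun d hd => hf d (by omega), rfl⟩
  mul i j := by
    rintro _ ⟨f, hf, rfl⟩ _ ⟨g, hg, rfl⟩
    exact ⟨f * g, mul_mem_highDegree hf hg, map_mul (truncate 𝕜 A K) f g⟩
  bot := by
    refine eq_bot_iff.2 ?_
    rintro _ ⟨f, hf, rfl⟩
    exact (truncate_eq_zero (𝕜 := 𝕜)).2 hf

/-- The `n`-th power has no terms of degree below `n`, so the summands from `K` on vanish in the
quotient. -/
theorem truncate_expSeries {f : Series A} (hf : f 0 = 0) (K : ℕ) :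
    truncate 𝕜 A K (expSeries 𝕜 f) = truncExp 𝕜 K (truncate 𝕜 A K f) := by
  have h : truncExp 𝕜 K (truncate 𝕜 A K f) = truncate 𝕜 A K (truncExp 𝕜 K f) := by
    simp only [truncExp, map_sum, map_smul, map_pow]
  rw [h, truncate_eq]
  intro d hd
  rw [expSeries, finsum_eq_sum_of_support_subset (s := Finset.range K)]
  · rw [truncExp]
    exact (map_sum (coeffAt 𝕜 d) (fun k => (k.factorial : 𝕜)⁻¹ • f ^ k) (Finset.range K)).symm
  · intro n hn
    by_contra hc
    refine hn ?_
    rw [Finset.mem_coe, Finset.mem_range, not_lt] at hc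
    simp only [pow_apply_eq_zero hf n d (by omega), smul_zero]

namespace NilFiltration

variable {Q : Type*} [Ring Q] [Algebra 𝕜 Q] {J : ℕ → Submodule 𝕜 Q} {n : ℕ}
  (hJ : NilFiltration J (n + 1))
include hJ

/-- A product of `x` with a positive power of `f` lies in `J (n + 1) = ⊥`, so the exponential acts
as 1. -/
theorem mul_truncExp_eq {x f : Q} (hx : x ∈ J n) (hf : f ∈ J 1) :
    x * truncExp 𝕜 (n + 1) f = x ∧ truncExp 𝕜 (n + 1) f * x = x := by
  have h : ∀ k, f ^ (k + 1) ∈ J 1 := fun k => hJ.anti (by omega) (hJ.pow_mem hf (k + 1))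
  have h1 : ∀ k, x * f ^ (k + 1) = 0 := fun k => hJ.eq_zero le_rfl (hJ.mul n 1 _ hx _ (h k))
  have h2 : ∀ k, f ^ (k + 1) * x = 0 := fun k =>
    hJ.eq_zero (add_comm 1 n).ge (hJ.mul 1 n _ (h k) _ hx)
  rw [truncExp, Finset.sum_range_succ']
  constructor
  · simp [mul_add, Finset.mul_sum, h1]
  · simp [add_mul, Finset.sum_mul, h2]

/-- Squares already agree, since `f² - g² = f(f - g) + (f - g)g` lies in `J (n + 1) = ⊥`; only the
linear terms differ. -/
theorem truncExp_sub_truncExp (hn : 1 ≤ n) {f g : Q} (hf : f ∈ J 1) (hg : g ∈ J 1)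
    (hfg : f - g ∈ J n) : truncExp 𝕜 (n + 1) f - truncExp 𝕜 (n + 1) g = f - g := by
  have hpow : ∀ k, f ^ (k + 1) - g ^ (k + 1) ∈ J n ∧ f ^ (k + 2) = g ^ (k + 2) := by
    intro k
    induction k with
    | zero =>
      refine ⟨by simpa using hfg, ?_⟩
      rw [← sub_eq_zero]
      have e : f ^ (0 + 2) - g ^ (0 + 2) = f * (f - g) + (f - g) * g := by noncomm_ring
      rw [e, hJ.eq_zero (add_comm 1 n).ge (hJ.mul 1 n _ hf _ hfg),
        hJ.eq_zero le_rfl (hJ.mul n 1 _ hfg _ hg), add_zero]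
    | succ k ih =>
      refine ⟨by rw [ih.2, sub_self]; exact zero_mem _, ?_⟩
      rw [pow_succ' f, pow_succ' g, ih.2, ← sub_eq_zero, ← sub_mul]
      refine hJ.eq_zero le_rfl (hJ.mul n 1 _ hfg _ (hJ.anti (by omega) (hJ.pow_mem hg (k + 2))))
  obtain ⟨n, rfl⟩ : ∃ m, n = m + 1 := ⟨n - 1, by omega⟩
  rw [truncExp, truncExp, ← Finset.sum_sub_distrib, Finset.sum_range_succ', Finset.sum_range_succ']
  simp [hpow]

/-- Two factorizations into exponentials that agree up to high degree have the same sum of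
logarithms. -/
theorem sub_add_sub_eq_zero (hn : 1 ≤ n) {a a' b b' : Q} (ha : a ∈ J 1) (ha' : a' ∈ J 1)
    (hb : b ∈ J 1) (hb' : b' ∈ J 1) (haa : a - a' ∈ J n) (hbb : b - b' ∈ J n)
    (h : truncExp 𝕜 (n + 1) a * truncExp 𝕜 (n + 1) b =
      truncExp 𝕜 (n + 1) a' * truncExp 𝕜 (n + 1) b') : (a - a') + (b - b') = 0 := by
  have e : truncExp 𝕜 (n + 1) a * truncExp 𝕜 (n + 1) b -
      truncExp 𝕜 (n + 1) a' * truncExp 𝕜 (n + 1) b' =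
      (truncExp 𝕜 (n + 1) a - truncExp 𝕜 (n + 1) a') * truncExp 𝕜 (n + 1) b +
      truncExp 𝕜 (n + 1) a' * (truncExp 𝕜 (n + 1) b - truncExp 𝕜 (n + 1) b') := by noncomm_ring
  rw [h, sub_self, hJ.truncExp_sub_truncExp hn ha ha' haa, hJ.truncExp_sub_truncExp hn hb hb' hbb,
    (hJ.mul_truncExp_eq haa hb).1, (hJ.mul_truncExp_eq hbb ha').2] at e
  exact e.symm

end NilFiltration

end Quotient

/-! ### Series over a Lie algebra inside those over the enveloping algebra -/

section Enveloping

attribute [local instance 100] LieRing.ofAssociativeRing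

variable {𝕜 L : Type*} [Field 𝕜] [LieRing L] [LieAlgebra 𝕜 L]

/-- The map `𝔤[[s,t]] → U(𝔤)[[s,t]]`. -/
def embed (𝕜 : Type*) (L : Type*) [Field 𝕜] [LieRing L] [LieAlgebra 𝕜 L] :
    Series L →ₗ[𝕜] Series (UniversalEnvelopingAlgebra 𝕜 L) where
  toFun := mapCoeff
    (UniversalEnvelopingAlgebra.ι 𝕜 : L →ₗ⁅𝕜⁆ UniversalEnvelopingAlgebra 𝕜 L).toLinearMap
  map_add' _ _ := funext fun _ => map_add _ _ _
  map_smul' _ _ := funext fun _ => map_smul _ _ _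

theorem embed_apply (f : Series L) (d : Fin 2 →₀ ℕ) :
    embed 𝕜 L f d = UniversalEnvelopingAlgebra.ι 𝕜 (f d) := rfl

theorem formalExp_eq (f : Series L) : formalExp 𝕜 f = expSeries 𝕜 (embed 𝕜 L f) := rfl

theorem embed_bracket (f g : Series L) : embed 𝕜 L (seriesBracket f g) =
    embed 𝕜 L f * embed 𝕜 L g - embed 𝕜 L g * embed 𝕜 L f := by
  funext d
  change _ = MvPowerSeries.coeff d (embed 𝕜 L f * embed 𝕜 L g) -
    MvPowerSeries.coeff d (embed 𝕜 L g * embed 𝕜 L f)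
  have hswap : ∑ p ∈ Finset.HasAntidiagonal.antidiagonal d,
      MvPowerSeries.coeff p.1 (embed 𝕜 L g) * MvPowerSeries.coeff p.2 (embed 𝕜 L f) =
      ∑ p ∈ Finset.HasAntidiagonal.antidiagonal d,
        MvPowerSeries.coeff p.2 (embed 𝕜 L g) * MvPowerSeries.coeff p.1 (embed 𝕜 L f) := by
    conv_lhs => rw [← Finset.HasAntidiagonal.map_swap_antidiagonal, Finset.sum_map]
    rfl
  rw [embed_apply, seriesBracket, map_sum, MvPowerSeries.coeff_mul, MvPowerSeries.coeff_mul,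
    hswap, ← Finset.sum_sub_distrib]
  refine Finset.sum_congr rfl fun p _ => ?_
  rw [LieHom.map_lie, LieRing.of_associative_ring_bracket]
  rfl

theorem embed_zero_coeff {f : Series L} (hf : f 0 = 0) : embed 𝕜 L f 0 = 0 := by
  rw [embed_apply, hf, map_zero]

theorem embed_mem_highDegree {f : Series L} {k : ℕ}
    (hf : ∀ d : Fin 2 →₀ ℕ, d.degree < k → f d = 0) :
    embed 𝕜 L f ∈ highDegree _ k := fun d hd => by rw [embed_apply, hf d hd, map_zero]

theorem eq_zero_of_degree_lt_one {f : Series L} (hf : f 0 = 0) (d : Fin 2 →₀ ℕ)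
    (hd : d.degree < 1) : f d = 0 := by
  have : d = 0 := by rwa [Nat.lt_one_iff, Finsupp.degree_eq_zero_iff] at hd
  rw [this, hf]

/-- The factors of a product of exponentials of series with coefficients in complementary subspaces
are unique. -/
theorem formalExp_mul_injective {V W : Submodule 𝕜 L} (hVW : IsCompl V W)
    {a a' b b' : Series L}
    (ha : a ∈ seriesIn V) (ha' : a' ∈ seriesIn V) (hb : b ∈ seriesIn W) (hb' : b' ∈ seriesIn W)
    (ha0 : a 0 = 0) (ha0' : a' 0 = 0) (hb0 : b 0 = 0) (hb0' : b' 0 = 0)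
    (h : formalExp 𝕜 a * formalExp 𝕜 b = formalExp 𝕜 a' * formalExp 𝕜 b') : a = a' ∧ b = b' := by
  have key : ∀ n, ∀ d : Fin 2 →₀ ℕ, d.degree < n → a d = a' d ∧ b d = b' d := by
    intro n
    induction n with
    | zero => exact fun d hd => by omega
    | succ n ih =>
      intro d hd
      rcases Nat.eq_zero_or_pos n with rfl | hn
      · rw [eq_zero_of_degree_lt_one ha0 d hd, eq_zero_of_degree_lt_one ha0' d hd,
          eq_zero_of_degree_lt_one hb0 d hd, eq_zero_of_degree_lt_one hb0' d hd]
        exact ⟨rfl, rfl⟩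
      -- Modulo degree `n + 1`, the induction hypothesis puts the differences in the last nonzero
      -- step of the filtration.
      let τ := truncate 𝕜 (UniversalEnvelopingAlgebra 𝕜 L) (n + 1)
      have hJ := nilFiltration (𝕜 := 𝕜) (A := UniversalEnvelopingAlgebra 𝕜 L) (n + 1)
      have hone : ∀ f : Series L, f 0 = 0 → τ (embed 𝕜 L f) ∈ degreeFiltration 𝕜 _ (n + 1) 1 :=
        fun f hf => truncate_mem (embed_mem_highDegree (eq_zero_of_degree_lt_one hf))
      have hsub : ∀ f g : Series L, (∀ d : Fin 2 →₀ ℕ, d.degree < n → f d = g d) →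
          τ (embed 𝕜 L f) - τ (embed 𝕜 L g) ∈ degreeFiltration 𝕜 _ (n + 1) n := by
        intro f g hfg
        rw [← map_sub, ← map_sub]
        exact truncate_mem (embed_mem_highDegree fun d hd => sub_eq_zero.2 (hfg d hd))
      have hτ := congrArg τ h
      simp only [formalExp_eq, map_mul, τ, truncate_expSeries (embed_zero_coeff ha0),
        truncate_expSeries (embed_zero_coeff ha0'), truncate_expSeries (embed_zero_coeff hb0),
        truncate_expSeries (embed_zero_coeff hb0')] at hτ
      have h0 := hJ.sub_add_sub_eq_zero hn (hone a ha0) (hone a' ha0') (hone b hb0) (hone b' hb0')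
        (hsub a a' fun d hd => (ih d hd).1) (hsub b b' fun d hd => (ih d hd).2) hτ
      have e : τ (embed 𝕜 L a) - τ (embed 𝕜 L a') + (τ (embed 𝕜 L b) - τ (embed 𝕜 L b')) =
          τ (embed 𝕜 L ((a - a') + (b - b'))) := by simp only [map_add, map_sub]
      have h0 := truncate_eq_zero.1 (e.symm.trans h0)
      -- Injectivity of `ι` brings the relation back to `L`, where the complementary subspaces can
      -- be used.
      have h1 : (a d - a' d) + (b d - b' d) = 0 :=
        ι_injective 𝕜 ((h0 d hd).trans (map_zero _).symm)
      have h2 : a d - a' d ∈ V := sub_mem (ha d) (ha' d)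
      have h3 : b d - b' d ∈ W := sub_mem (hb d) (hb' d)
      have h4 : a d - a' d = 0 := by
        refine Submodule.disjoint_def.1 hVW.disjoint _ h2 ?_
        rw [eq_neg_of_add_eq_zero_left h1]
        exact neg_mem h3
      rw [h4, zero_add] at h1
      exact ⟨sub_eq_zero.1 h4, sub_eq_zero.1 h1⟩
  exact ⟨funext fun d => (key _ d (Nat.lt_succ_self _)).1,
    funext fun d => (key _ d (Nat.lt_succ_self _)).2⟩

end Enveloping

/-! ### Values of word series -/

section Values

variable {𝕜 : Type*} [Field 𝕜]

/-- The word series with given homogeneous components. -/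
def WordSeries.ofComponents (α : ℕ → Word →₀ 𝕜) : WordSeries 𝕜 :=
  ⟨fun w => α (w.countMinus + w.countPlus) w, fun m n =>
    ((α (m + n)).support.finite_toSet).subset fun w hw => by
      obtain ⟨h1, h2, h3⟩ := hw
      subst h1 h2
      exact Finsupp.mem_support_iff.2 h3⟩

theorem WordSeries.ofComponents_apply (α : ℕ → Word →₀ 𝕜) (w : Word) :
    (WordSeries.ofComponents α : Word → 𝕜) w = α (w.countMinus + w.countPlus) w := rfl

/-- The word series consisting of a multiple of a single word. -/
def WordSeries.single (w : Word) (c : 𝕜) : WordSeries 𝕜 :=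
  ⟨Pi.single w c, fun m n => (Set.finite_singleton w).subset fun v hv => by
    by_contra h
    exact hv.2.2 (Pi.single_eq_of_ne (M := fun _ => 𝕜) h c)⟩

variable {L : Type*} [LieRing L] [LieAlgebra 𝕜 L] {V W : Submodule 𝕜 L} (hVW : IsCompl V W)
  (x y : Series L)

/-- The value of a finite linear combination of words. -/
def evalFinite : (Word →₀ 𝕜) →ₗ[𝕜] Series L := Finsupp.linearCombination 𝕜 (Word.eval hVW x y)

theorem evalFinite_apply (z : Word →₀ 𝕜) (d : Fin 2 →₀ ℕ) :
    evalFinite hVW x y z d = ∑ w ∈ z.support, z w • w.eval hVW x y d := by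
  rw [evalFinite, Finsupp.linearCombination_apply, Finsupp.sum]
  exact map_sum (coeffAt (M := L) 𝕜 d) _ _

theorem evalSeries_single (w : Word) (c : 𝕜) :
    evalSeries hVW x y (WordSeries.single w c) = c • w.eval hVW x y := by
  funext d
  rw [evalSeries, finsum_eq_single _ w]
  · change (Pi.single w c : Word → 𝕜) w • _ = _
    rw [Pi.single_eq_same]
    rfl
  · intro v hv
    change (Pi.single w c : Word → 𝕜) v • _ = _
    rw [Pi.single_eq_of_ne hv, zero_smul]

variable {x y}

theorem evalSeries_add (hx : ∀ d : Fin 2 →₀ ℕ, d 0 = 0 → x d = 0)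
    (hy : ∀ d : Fin 2 →₀ ℕ, d 1 = 0 → y d = 0) (F G : WordSeries 𝕜) :
    evalSeries hVW x y (F + G) = evalSeries hVW x y F + evalSeries hVW x y G := by
  funext d
  change _ = evalSeries hVW x y F d + evalSeries hVW x y G d
  rw [evalSeries, evalSeries, evalSeries, ← finsum_add_distrib
    (finite_support_evalSeries hVW hx hy F d) (finite_support_evalSeries hVW hx hy G d)]
  refine finsum_congr fun w => ?_
  rw [← add_smul]
  rfl

/-- A word with more than `d.degree` letters has value zero at `d`, as each letter contributes a
factor s or t. -/
theorem evalSeries_ofComponents (hx : ∀ d : Fin 2 →₀ ℕ, d 0 = 0 → x d = 0)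
    (hy : ∀ d : Fin 2 →₀ ℕ, d 1 = 0 → y d = 0) {α : ℕ → Word →₀ 𝕜}
    (hα : ∀ n, α n ∈ Finsupp.supported 𝕜 𝕜 {w : Word | w.countMinus + w.countPlus = n})
    {K : ℕ} {d : Fin 2 →₀ ℕ} (hd : d.degree < K) :
    evalSeries hVW x y (WordSeries.ofComponents α) d =
      (∑ n ∈ Finset.range K, evalFinite hVW x y (α n)) d := by
  have h : (∑ n ∈ Finset.range K, evalFinite hVW x y (α n)) d =
      ∑ n ∈ Finset.range K, evalFinite hVW x y (α n) d :=
    map_sum (coeffAt 𝕜 d) (fun n => evalFinite hVW x y (α n)) (Finset.range K)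
  have hlen : ∀ n, ∀ w ∈ (α n).support, w.countMinus + w.countPlus = n := fun n w hw => hα n hw
  have hdeg : d.degree = d 0 + d 1 := by rw [Finsupp.degree_eq_sum, Fin.sum_univ_two]
  rw [h, evalSeries, finsum_eq_sum_of_support_subset
    (s := (Finset.range K).biUnion fun n => (α n).support), Finset.sum_biUnion]
  · refine Finset.sum_congr rfl fun n _ => ?_
    rw [evalFinite_apply]
    refine Finset.sum_congr rfl fun w hw => ?_
    rw [WordSeries.ofComponents_apply, hlen n w hw]
  · intro m _ n _ hmn
    refine Finset.disjoint_left.2 fun w hw hw' => hmn ?_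
    rw [← hlen m w hw, hlen n w hw']
  · intro w hw
    rw [Function.mem_support, WordSeries.ofComponents_apply] at hw
    simp only [Finset.coe_biUnion, Set.mem_iUnion, Finset.mem_coe, Finset.mem_range]
    refine ⟨_, ?_, Finsupp.mem_support_iff.2 (left_ne_zero_of_smul hw)⟩
    by_contra hc
    refine right_ne_zero_of_smul hw (Word.eval_apply_eq_zero hVW hx hy w d ?_)
    omega

theorem evalSeries_apply_eq_zero (hx : ∀ d : Fin 2 →₀ ℕ, d 0 = 0 → x d = 0)
    (hy : ∀ d : Fin 2 →₀ ℕ, d 1 = 0 → y d = 0) (F : WordSeries 𝕜) (d : Fin 2 →₀ ℕ)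
    (h : ∀ w, (F : Word → 𝕜) w ≠ 0 → d 0 < w.countMinus ∨ d 1 < w.countPlus) :
    evalSeries hVW x y F d = 0 := by
  rw [evalSeries]
  refine finsum_eq_zero_of_forall_eq_zero fun w => ?_
  by_cases hw : (F : Word → 𝕜) w = 0
  · rw [hw, zero_smul]
  · rw [Word.eval_apply_eq_zero hVW hx hy w d (h w hw), smul_zero]

theorem evalFinite_wordMinus (z : Word →₀ 𝕜) :
    evalFinite hVW x y (wordMinus 𝕜 z) ∈ seriesIn V := by
  rw [evalFinite, wordMinus, Finsupp.lmapDomain_apply, Finsupp.linearCombination_mapDomain,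
    Finsupp.linearCombination_apply]
  exact sum_mem fun w _ => Submodule.smul_mem _ _ fun d => Submodule.projection_apply_mem hVW _

theorem evalFinite_wordPlus (z : Word →₀ 𝕜) :
    evalFinite hVW x y (wordPlus 𝕜 z) ∈ seriesIn W := by
  rw [evalFinite, wordPlus, Finsupp.lmapDomain_apply, Finsupp.linearCombination_mapDomain,
    Finsupp.linearCombination_apply]
  exact sum_mem fun w _ => Submodule.smul_mem _ _ fun d => Submodule.projection_apply_mem hVW.symm _

theorem evalFinite_factorMinus (hxV : x ∈ seriesIn V) (n : ℕ) :
    evalFinite hVW x y (factorMinus 𝕜 n) ∈ seriesIn V := by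
  rw [factorMinus_eq, map_smul, map_sub]
  refine Submodule.smul_mem _ _ (sub_mem ?_ (evalFinite_wordMinus hVW _))
  split_ifs
  · rw [evalFinite, Finsupp.linearCombination_single, one_smul]
    exact hxV
  · rw [map_zero]
    exact zero_mem _

theorem evalFinite_factorPlus (hyW : y ∈ seriesIn W) (n : ℕ) :
    evalFinite hVW x y (factorPlus 𝕜 n) ∈ seriesIn W := by
  rw [factorPlus_eq, map_smul, map_sub]
  refine Submodule.smul_mem _ _ (sub_mem ?_ (evalFinite_wordPlus hVW _))
  split_ifs
  · rw [evalFinite, Finsupp.linearCombination_single, one_smul]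
    exact hyW
  · rw [map_zero]
    exact zero_mem _

end Values

/-! ### The canonical factorization -/

section Canonical

variable (𝕜 : Type*) [Field 𝕜]

/-- The word series of the first factor. -/
def seriesMinus : WordSeries 𝕜 := WordSeries.ofComponents (factorMinus 𝕜)

/-- The word series of the second factor. -/
def seriesPlus : WordSeries 𝕜 := WordSeries.ofComponents (factorPlus 𝕜)

/-- The terms with at least three letters of the word series of the first factor. -/
def higherMinus : WordSeries 𝕜 :=
  WordSeries.ofComponents fun n => if 3 ≤ n then factorMinus 𝕜 n else 0

/-- The terms with at least three letters of the word series of the second factor. -/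
def higherPlus : WordSeries 𝕜 :=
  WordSeries.ofComponents fun n => if 3 ≤ n then factorPlus 𝕜 n else 0

variable {𝕜}

theorem isHigher_of_higherMinus (w : Word) (hw : (higherMinus 𝕜 : Word → 𝕜) w ≠ 0) :
    w.IsHigher := by
  rw [higherMinus, WordSeries.ofComponents_apply] at hw
  split_ifs at hw with h
  · exact ⟨h, ((factors_mem _).2.2.1 (by omega) (Finsupp.mem_support_iff.2 hw)).2⟩
  · exact absurd rfl hw

theorem isHigher_of_higherPlus (w : Word) (hw : (higherPlus 𝕜 : Word → 𝕜) w ≠ 0) :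
    w.IsHigher := by
  rw [higherPlus, WordSeries.ofComponents_apply] at hw
  split_ifs at hw with h
  · exact ⟨h, ((factors_mem _).2.2.2.2 (by omega) (Finsupp.mem_support_iff.2 hw)).2⟩
  · exact absurd rfl hw

/-- A sequence with one word in each of the degrees one and two. -/
theorem apply_eq_of_low {α : ℕ → Word →₀ 𝕜} {v₁ v₂ : Word} {c : 𝕜} (h0 : α 0 = 0)
    (h1 : α 1 = Finsupp.single v₁ 1) (h2 : α 2 = Finsupp.single v₂ c)
    (hv₁ : v₁.countMinus + v₁.countPlus = 1) (hv₂ : v₂.countMinus + v₂.countPlus = 2) (w : Word) :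
    α (w.countMinus + w.countPlus) w =
      (Pi.single v₁ 1 : Word → 𝕜) w + (Pi.single v₂ c : Word → 𝕜) w +
        (if 3 ≤ w.countMinus + w.countPlus then α (w.countMinus + w.countPlus) else 0) w := by
  have e1 : w.countMinus + w.countPlus ≠ 1 → (Pi.single v₁ 1 : Word → 𝕜) w = 0 := fun h =>
    Pi.single_eq_of_ne (by rintro rfl; exact h hv₁) _
  have e2 : w.countMinus + w.countPlus ≠ 2 → (Pi.single v₂ c : Word → 𝕜) w = 0 := fun h =>
    Pi.single_eq_of_ne (by rintro rfl; exact h hv₂) _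
  generalize w.countMinus + w.countPlus = n at e1 e2 ⊢
  rcases n with _ | _ | _ | n
  · rw [e1 (by omega), e2 (by omega)]
    simp [h0]
  · rw [e2 (by omega)]
    simp [h1, Finsupp.single_eq_pi_single]
  · rw [e1 (by omega)]
    simp [h2, Finsupp.single_eq_pi_single]
  · rw [e1 (by omega), e2 (by omega)]
    simp

theorem seriesMinus_eq : seriesMinus 𝕜 = WordSeries.single Word.minus 1 +
    WordSeries.single (Word.projMinus (Word.bracket Word.plus Word.minus)) (1 / 2) +
    higherMinus 𝕜 :=
  Subtype.ext (funext (apply_eq_of_low factorMinus_zero factorMinus_one factorMinus_two rfl rfl))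

theorem seriesPlus_eq : seriesPlus 𝕜 = WordSeries.single Word.plus 1 +
    WordSeries.single (Word.projPlus (Word.bracket Word.plus Word.minus)) (1 / 2) +
    higherPlus 𝕜 :=
  Subtype.ext (funext (apply_eq_of_low factorPlus_zero factorPlus_one factorPlus_two rfl rfl))

variable {L : Type*} [LieRing L] [LieAlgebra 𝕜 L] {V W : Submodule 𝕜 L} (hVW : IsCompl V W)
  {x y : Series L} (hx : ∀ d : Fin 2 →₀ ℕ, d 0 = 0 → x d = 0)
  (hy : ∀ d : Fin 2 →₀ ℕ, d 1 = 0 → y d = 0)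

theorem factorMinus_mem_supported (n : ℕ) : factorMinus 𝕜 n ∈
    Finsupp.supported 𝕜 𝕜 {w : Word | w.countMinus + w.countPlus = n} :=
  Finsupp.supported_mono (fun _ hw => hw.1) (factors_mem n).2.1

theorem factorPlus_mem_supported (n : ℕ) : factorPlus 𝕜 n ∈
    Finsupp.supported 𝕜 𝕜 {w : Word | w.countMinus + w.countPlus = n} :=
  Finsupp.supported_mono (fun _ hw => hw.1) (factors_mem n).2.2.2.1

include hx hy

theorem evalSeries_seriesMinus_mem (hxV : x ∈ seriesIn V) :
    evalSeries hVW x y (seriesMinus 𝕜) ∈ seriesIn V := by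
  intro d
  rw [seriesMinus, evalSeries_ofComponents hVW hx hy factorMinus_mem_supported
    (Nat.lt_succ_self d.degree)]
  exact (sum_mem fun n _ => evalFinite_factorMinus hVW hxV n :
    ∑ n ∈ Finset.range _, evalFinite hVW x y (factorMinus 𝕜 n) ∈ seriesIn V) d

theorem evalSeries_seriesPlus_mem (hyW : y ∈ seriesIn W) :
    evalSeries hVW x y (seriesPlus 𝕜) ∈ seriesIn W := by
  intro d
  rw [seriesPlus, evalSeries_ofComponents hVW hx hy factorPlus_mem_supported
    (Nat.lt_succ_self d.degree)]
  exact (sum_mem fun n _ => evalFinite_factorPlus hVW hyW n :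
    ∑ n ∈ Finset.range _, evalFinite hVW x y (factorPlus 𝕜 n) ∈ seriesIn W) d

/-- Every word of the first factor contains `minus`, so the value is divisible by s; this is what
allows solving for g⁻. -/
theorem evalSeries_seriesMinus_eq_zero (d : Fin 2 →₀ ℕ) (hd : d 0 = 0) :
    evalSeries hVW x y (seriesMinus 𝕜) d = 0 := by
  refine evalSeries_apply_eq_zero hVW hx hy _ d fun w hw => Or.inl ?_
  have := ((factors_mem _).2.1 (Finsupp.mem_support_iff.2 hw)).2
  omega

theorem evalSeries_seriesPlus_eq_zero (d : Fin 2 →₀ ℕ) (hd : d 1 = 0) :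
    evalSeries hVW x y (seriesPlus 𝕜) d = 0 := by
  refine evalSeries_apply_eq_zero hVW hx hy _ d fun w hw => Or.inr ?_
  have := ((factors_mem _).2.2.2.1 (Finsupp.mem_support_iff.2 hw)).2
  omega

theorem evalSeries_seriesMinus_add :
    evalSeries hVW x y (seriesMinus 𝕜) = x + (1 / 2 : 𝕜) • mapCoeff (V.projection W hVW)
      (seriesBracket y x) + evalSeries hVW x y (higherMinus 𝕜) := by
  rw [seriesMinus_eq, evalSeries_add hVW hx hy, evalSeries_add hVW hx hy, evalSeries_single,
    evalSeries_single, one_smul]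
  rfl

theorem evalSeries_seriesPlus_add :
    evalSeries hVW x y (seriesPlus 𝕜) = y + (1 / 2 : 𝕜) • mapCoeff (W.projection V hVW.symm)
      (seriesBracket y x) + evalSeries hVW x y (higherPlus 𝕜) := by
  rw [seriesPlus_eq, evalSeries_add hVW hx hy, evalSeries_add hVW hx hy, evalSeries_single,
    evalSeries_single, one_smul]
  rfl

/-- The canonical factorization of `e ^ (x + y)`. -/
theorem formalExp_mul_formalExp [CharZero 𝕜] :
    formalExp 𝕜 (evalSeries hVW x y (seriesMinus 𝕜)) *
      formalExp 𝕜 (evalSeries hVW x y (seriesPlus 𝕜)) = formalExp 𝕜 (x + y) := by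
  have hm0 := evalSeries_seriesMinus_eq_zero (𝕜 := 𝕜) hVW hx hy 0 rfl
  have hp0 := evalSeries_seriesPlus_eq_zero (𝕜 := 𝕜) hVW hx hy 0 rfl
  have hxy0 : (x + y) 0 = 0 := by
    change x 0 + y 0 = 0
    rw [hx 0 rfl, hy 0 rfl, add_zero]
  have key : ∀ K, truncate 𝕜 _ K (formalExp 𝕜 (evalSeries hVW x y (seriesMinus 𝕜)) *
      formalExp 𝕜 (evalSeries hVW x y (seriesPlus 𝕜))) = truncate 𝕜 _ K (formalExp 𝕜 (x + y)) := by
    intro K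
    let φ := (truncate 𝕜 (UniversalEnvelopingAlgebra 𝕜 L) K).toLinearMap ∘ₗ embed 𝕜 L
    have hφ : ∀ f, truncate 𝕜 _ K (embed 𝕜 L f) = φ f := fun _ => rfl
    have hlin : ∀ z, Finsupp.linearCombination 𝕜 (fun w => φ (Word.eval hVW x y w)) z =
        φ (evalFinite hVW x y z) := fun z =>
      (Finsupp.apply_linearCombination 𝕜 φ (Word.eval hVW x y) z).symm
    have hval : ∀ f g : Series L, (∀ d : Fin 2 →₀ ℕ, d.degree < K → f d = g d) → φ f = φ g := by
      intro f g h
      rw [← hφ, ← hφ, truncate_eq]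
      intro d hd
      rw [embed_apply, embed_apply, h d hd]
    have hm : φ (evalSeries hVW x y (seriesMinus 𝕜)) = ∑ n ∈ Finset.range K,
        Finsupp.linearCombination 𝕜 (fun w => φ (Word.eval hVW x y w)) (factorMinus 𝕜 n) := by
      simp only [hlin]
      rw [← map_sum]
      exact hval _ _ fun d hd => evalSeries_ofComponents hVW hx hy factorMinus_mem_supported hd
    have hp : φ (evalSeries hVW x y (seriesPlus 𝕜)) = ∑ n ∈ Finset.range K,
        Finsupp.linearCombination 𝕜 (fun w => φ (Word.eval hVW x y w)) (factorPlus 𝕜 n) := by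
      simp only [hlin]
      rw [← map_sum]
      exact hval _ _ fun d hd => evalSeries_ofComponents hVW hx hy factorPlus_mem_supported hd
    rw [map_mul, formalExp_eq, formalExp_eq, formalExp_eq,
      truncate_expSeries (embed_zero_coeff hm0), truncate_expSeries (embed_zero_coeff hp0),
      truncate_expSeries (embed_zero_coeff hxy0), hφ, hφ, hφ, hm, hp, map_add]
    -- It remains to check that evaluation turns brackets into commutators, that the two projections
    -- add up to the identity, and that the number of letters bounds the degree from below.
    refine truncExp_factors (nilFiltration K) (fun w => φ (Word.eval hVW x y w)) ?_ ?_ ?_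
    · intro v w
      change truncate 𝕜 _ K (embed 𝕜 L (seriesBracket _ _)) = _
      rw [embed_bracket, map_sub, map_mul, map_mul]
      rfl
    · intro w
      rw [← map_add]
      refine hval _ _ fun d _ => ?_
      exact Submodule.projection_add_projection_eq_self hVW _
    · intro w
      refine truncate_mem (embed_mem_highDegree fun d hd =>
        Word.eval_apply_eq_zero hVW hx hy w d ?_)
      rw [Finsupp.degree_eq_sum, Fin.sum_univ_two] at hd
      omega
  funext d
  exact truncate_eq.1 (key (d.degree + 1)) d (Nat.lt_succ_self _)

end Canonical

/-! ### Multiplication and division by a variable. -/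

section MulVar

variable {M : Type*} [AddCommGroup M]

theorem mulVar_eq_zero (i : Fin 2) (f : Series M) (d : Fin 2 →₀ ℕ) (hd : d i = 0) :
    mulVar i f d = 0 := if_pos hd

theorem mulVar_injective (i : Fin 2) : Function.Injective (mulVar i : Series M → Series M) := by
  intro f g h
  funext d
  have := congrFun h (d + Finsupp.single i 1)
  simpa [mulVar] using this

theorem exists_mulVar_eq (i : Fin 2) {f : Series M} (hf : ∀ d : Fin 2 →₀ ℕ, d i = 0 → f d = 0) :
    mulVar i (fun d => f (d + Finsupp.single i 1)) = f := by
  funext d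
  change (if d i = 0 then 0 else f (d - Finsupp.single i 1 + Finsupp.single i 1)) = f d
  split_ifs with h
  · exact (hf d h).symm
  · rw [tsub_add_cancel_of_le]
    rw [Finsupp.single_le_iff]
    omega

theorem mulVar_mem {𝕜 : Type*} [Field 𝕜] [Module 𝕜 M] {V : Submodule 𝕜 M} (i : Fin 2)
    {f : Series M} (hf : f ∈ seriesIn V) : mulVar i f ∈ seriesIn V := by
  intro d
  rw [mulVar]
  split_ifs
  · exact zero_mem _
  · exact hf _

end MulVar

end FormalFactorization

end

/-! ### The factorization theorem. -/

theorem theorem3p6 {𝔽 : Type*} [Field 𝔽] [CharZero 𝔽] :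
    -- the canonical factorization series `F⁻`, `F⁺` and their higher-order parts `U⁻`, `U⁺`
    ∃ Fm Fp Um Up : WordSeries 𝔽,
      (∀ w : Word, (Um : Word → 𝔽) w ≠ 0 → w.IsHigher) ∧
      (∀ w : Word, (Up : Word → 𝔽) w ≠ 0 → w.IsHigher) ∧
      (Fm : Word → 𝔽) = (Pi.single Word.minus 1 : Word → 𝔽) +
        Pi.single (Word.projMinus (Word.bracket Word.plus Word.minus)) (1 / 2 : 𝔽) + (Um : Word → 𝔽) ∧
      (Fp : Word → 𝔽) = (Pi.single Word.plus 1 : Word → 𝔽) +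
        Pi.single (Word.projPlus (Word.bracket Word.plus Word.minus)) (1 / 2 : 𝔽) + (Up : Word → 𝔽) ∧
      ∀ (L : Type*) [LieRing L] [LieAlgebra 𝔽 L] (Lm Lp : Submodule 𝔽 L) (hL : IsCompl Lm Lp),
        ∀ hm ∈ seriesIn Lm, ∀ hp ∈ seriesIn Lp,
          -- `g⁻`, `g⁺` exist and are unique
          (∃! g : Series L × Series L, g.1 ∈ seriesIn Lm ∧ g.2 ∈ seriesIn Lp ∧
            formalExp 𝔽 (mulVar 0 g.1) * formalExp 𝔽 (mulVar 1 g.2) =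
              formalExp 𝔽 (mulVar 0 hm + mulVar 1 hp)) ∧
          ∀ gm ∈ seriesIn Lm, ∀ gp ∈ seriesIn Lp,
            formalExp 𝔽 (mulVar 0 gm) * formalExp 𝔽 (mulVar 1 gp) =
              formalExp 𝔽 (mulVar 0 hm + mulVar 1 hp) →
            mulVar 0 gm ∈ completion hL (mulVar 0 hm) (mulVar 1 hp) ∧
            mulVar 1 gp ∈ completion hL (mulVar 0 hm) (mulVar 1 hp) ∧
            mulVar 0 gm = evalSeries hL (mulVar 0 hm) (mulVar 1 hp) Fm ∧
            mulVar 1 gp = evalSeries hL (mulVar 0 hm) (mulVar 1 hp) Fp ∧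
            (∃ um ∈ completion hL (mulVar 0 hm) (mulVar 1 hp), um ∈ seriesIn Lm ∧
              um = evalSeries hL (mulVar 0 hm) (mulVar 1 hp) Um ∧
              mulVar 0 gm = mulVar 0 hm + (1 / 2 : 𝔽) • mapCoeff (Lm.projection Lp hL)
                (seriesBracket (mulVar 1 hp) (mulVar 0 hm)) + um) ∧
            (∃ up ∈ completion hL (mulVar 0 hm) (mulVar 1 hp), up ∈ seriesIn Lp ∧
              up = evalSeries hL (mulVar 0 hm) (mulVar 1 hp) Up ∧
              mulVar 1 gp = mulVar 1 hp + (1 / 2 : 𝔽) • mapCoeff (Lp.projection Lm hL.symm)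
                (seriesBracket (mulVar 1 hp) (mulVar 0 hm)) + up) := by
  refine ⟨seriesMinus 𝔽, seriesPlus 𝔽, higherMinus 𝔽, higherPlus 𝔽, isHigher_of_higherMinus,
    isHigher_of_higherPlus, congrArg Subtype.val seriesMinus_eq,
    congrArg Subtype.val seriesPlus_eq, ?_⟩
  intro L _ _ Lm Lp hL hm hhm hp hhp
  have hx : ∀ d : Fin 2 →₀ ℕ, d 0 = 0 → mulVar 0 hm d = 0 := mulVar_eq_zero 0 hm
  have hy : ∀ d : Fin 2 →₀ ℕ, d 1 = 0 → mulVar 1 hp d = 0 := mulVar_eq_zero 1 hp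
  have hxV := mulVar_mem 0 hhm
  have hyW := mulVar_mem 1 hhp
  have ha := evalSeries_seriesMinus_mem hL hx hy hxV
  have hb := evalSeries_seriesPlus_mem hL hx hy hyW
  have hexp := formalExp_mul_formalExp hL hx hy
  have hadd := evalSeries_seriesMinus_add hL hx hy
  have hadd' := evalSeries_seriesPlus_add hL hx hy
  have hma := exists_mulVar_eq 0 (evalSeries_seriesMinus_eq_zero (𝕜 := 𝔽) hL hx hy)
  have hmb := exists_mulVar_eq 1 (evalSeries_seriesPlus_eq_zero (𝕜 := 𝔽) hL hx hy)
  set a := evalSeries hL (mulVar 0 hm) (mulVar 1 hp) (seriesMinus 𝔽) with ha_def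
  set b := evalSeries hL (mulVar 0 hm) (mulVar 1 hp) (seriesPlus 𝔽) with hb_def
  have huniq : ∀ gm ∈ seriesIn Lm, ∀ gp ∈ seriesIn Lp,
      formalExp 𝔽 (mulVar 0 gm) * formalExp 𝔽 (mulVar 1 gp) =
        formalExp 𝔽 (mulVar 0 hm + mulVar 1 hp) → mulVar 0 gm = a ∧ mulVar 1 gp = b := by
    intro gm hgm gp hgp h
    refine formalExp_mul_injective hL (mulVar_mem 0 hgm) ha (mulVar_mem 1 hgp) hb
      (mulVar_eq_zero 0 gm 0 rfl) ?_ (mulVar_eq_zero 1 gp 0 rfl) ?_ (h.trans hexp.symm)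
    · rw [← hma]
      exact mulVar_eq_zero 0 _ 0 rfl
    · rw [← hmb]
      exact mulVar_eq_zero 1 _ 0 rfl
  -- Shifting the exponents divides `a` by s and `b` by t.
  refine ⟨⟨(fun d => a (d + Finsupp.single 0 1), fun d => b (d + Finsupp.single 1 1)),
    ⟨fun d => ha _, fun d => hb _, ?_⟩, ?_⟩, ?_⟩
  · rw [hma, hmb, hexp]
  · rintro ⟨gm, gp⟩ ⟨hgm, hgp, h⟩
    obtain ⟨h1, h2⟩ := huniq gm hgm gp hgp h
    exact Prod.ext (mulVar_injective 0 (h1.trans hma.symm)) (mulVar_injective 1 (h2.trans hmb.symm))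
  · intro gm hgm gp hgp h
    obtain ⟨h1, h2⟩ := huniq gm hgm gp hgp h
    rw [h1, h2]
    refine ⟨⟨_, rfl⟩, ⟨_, rfl⟩, rfl, rfl, ⟨_, ⟨_, rfl⟩, ?_, rfl, hadd⟩, ⟨_, ⟨_, rfl⟩, ?_, rfl, hadd'⟩⟩
    -- The higher part is the value of the whole factor minus its terms of low order, all of which
    -- have coefficients in `Lm`.
    · rw [← sub_eq_of_eq_add' hadd]
      exact sub_mem ha (add_mem hxV (Submodule.smul_mem _ _ fun d =>
        Submodule.projection_apply_mem hL _))
    · rw [← sub_eq_of_eq_add' hadd']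
      exact sub_mem hb (add_mem hyW (Submodule.smul_mem _ _ fun d =>
        Submodule.projection_apply_mem hL.symm _))
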